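/- **Setting.** Let $d,n,l\ge 1$ and $r\ge 0$ be integers with $l\mid n$, let $\Lambda=\{1,\dots,n\}^d$, and let each site $j\in\Lambda$ carry a complex Hilbert space, finite- or infinite-dimensional, with an orthonormal basis $X_j$. Operators on tensor products of sites are given by their matrices in the product basis. Let $H=\sum_{i\in\Lambda}H_{B_r(i)}$ be an $r$-local Hamiltonian, not necessarily translation-invariant: each $H_{B_r(i)}$ is Hermitian, possibly unbounded, and acts only on the sites of the Manhattan ball $B_r(i)=\{j\in\Lambda: d(i,j)\le r\}$. Assume that $H$ (that is, a self-adjoint realisation of its matrix) has ground state energy $0$ and that $Z_T=\operatorname{tr}e^{-H/T}<\infty$ for all $T>0$. Put $\rho_T=e^{-H/T}/Z_T$ for $T>0$, and let $\rho_0$ be the maximally mixed state on the ground space. Let $$u(T)=\frac{\operatorname{tr}(H\rho_T)}{n^d},\qquad s(T)=\frac{S(\rho_T)}{n^d},\qquad c(T)=\dot u(T),$$ where $S$ is the von Neumann entropy (natural logarithm). Partition $\Lambda$ into $M=(n/l)^d$ cubes $R_m=v_m+\{1,\dots,l\}^d$, with boundaries $\partial R_m=R_m\setminus(v_m+\{1+r,\dots,l-r\}^d)$.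 For a state $\sigma$ let $\sigma_R$ be its reduced state on $R$, let $\tilde\sigma=\bigotimes_m\sigma_{R_m}$, let $\mathbb E[S(\sigma_R)]=\frac1M\sum_m S(\sigma_{R_m})$, and let $$h(\sigma)=\min\Bigl\{\max_{i\in\Lambda}\|H_{B_r(i)}\|,\ \max_m\max_{i\in\partial R_m}\bigl|\operatorname{tr}\bigl(H_{B_r(i)}(\sigma-\tilde\sigma)\bigr)\bigr|\Bigr\},$$ where the norm of an unbounded operator is $\infty$. (If $B_r(i)$ meets only two cubes, in $A$ and $B$, and $H_{B_r(i)}=\sum_k h_A^{(k)}\otimes h_B^{(k)}$, then $\operatorname{tr}(H_{B_r(i)}(\sigma-\tilde\sigma))=\sum_k\operatorname{Cov}_\sigma(h_A^{(k)\dagger},h_B^{(k)})$.) Expectation values $\operatorname{tr}(A\rho)$ are limits of $\sum_{x,y\in N}A_{xy}\rho_{yx}$ along finite sets $N$ of basis vectors. **Proposition.** Let $\sigma$ be a state for which all $\operatorname{tr}(H_{B_r(i)}\sigma)$ and $\operatorname{tr}(H_{B_r(i)}\tilde\sigma)$ exist (automatic for bounded terms), and let $\operatorname{tr}(H\sigma)\le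 Cn^d/l$ for some $C\ge1$. Let $T_c>0$ satisfy $u(T_c)=\dfrac{C+4dr\,h(\sigma)}{l}$. Then, for all $k,\gamma,\Delta>0$, $$\mathbb E[S(\sigma_R)]\le s(0)\,l^d+F\,l^{d-1},$$ where one may take: 1. if $c(T)\le k(T/\Delta)^\gamma$ for all $0<T\le T_c$, $$F=\frac{k^{\frac1{\gamma+1}}}{\gamma}(\gamma+1)^{\frac{\gamma}{\gamma+1}}\Bigl(\frac{C+4dr\,h(\sigma)}{\Delta}\Bigr)^{\frac{\gamma}{\gamma+1}}l^{\frac1{\gamma+1}};$$ 2. if $c(T)\le k(\Delta/T)^\gamma e^{-\Delta/T}$ for all $0<T\le T_c$, $$F=2\Bigl(\max\bigl\{0,\ \ln(k\Delta\gamma^{\gamma-1})+\ln l\bigr\}+1+\frac\gamma2\Bigr)\frac{C+4dr\,h(\sigma)}{\Delta}.$$ -/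

import Mathlib

open Filter Topology
open scoped ENNReal lp ComplexOrder

noncomputable section

namespace AreaLaw

/-! ### Matrices indexed by an orthonormal basis

A Hilbert space with orthonormal basis labelled by `Y` is `ℓ²(Y, ℂ)`; `Y` may be infinite.
States and (possibly unbounded) observables are given by their matrix elements in that basis. -/

section Matrices

variable {Y : Type*}

/-- Density matrices: positive semidefinite with trace one. -/
structure IsDensity (ρ : Matrix Y Y ℂ) : Prop where
  posSemidef : ρ.PosSemidef
  trace_one : HasSum (fun x => ρ x x) 1

/-- The trace `tr (A ρ)` truncated to the finite set `N` of basis vectors. -/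
def truncTrace (A ρ : Matrix Y Y ℂ) (N : Finset Y) : ℂ :=
  ∑ x ∈ N, ∑ y ∈ N, A x y * ρ y x

/-- `tr (A ρ)` exists, as the limit of its truncations along finite sets of basis vectors.
This is automatic when `Y` is finite. -/
def HasTrace (A ρ : Matrix Y Y ℂ) : Prop :=
  ∃ v : ℂ, Tendsto (truncTrace A ρ) atTop (𝓝 v)

/-- The expectation value `tr (A ρ)`. -/
def expect (A ρ : Matrix Y Y ℂ) : ℂ :=
  limUnder atTop (truncTrace A ρ)

/-- The operator norm `sup |⟨φ, A ψ⟩|` over finitely supported `φ`, `ψ` of norm at most one;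
it is `∞` if `A` is unbounded. -/
def opNorm (A : Matrix Y Y ℂ) : ℝ≥0∞ :=
  ⨆ (φ : Y →₀ ℂ) (ψ : Y →₀ ℂ) (_ : φ.sum (fun _ a => ‖a‖ ^ 2) ≤ 1)
    (_ : ψ.sum (fun _ a => ‖a‖ ^ 2) ≤ 1),
    ‖φ.sum fun x a => ψ.sum fun y c => star a * A x y * c‖ₑ

/-- The eigenspace in `ℓ²(Y, ℂ)` of the operator with matrix `ρ`. -/
def eigenspace (ρ : Matrix Y Y ℂ) (μ : ℝ) : Submodule ℂ ℓ²(Y, ℂ) where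
  carrier := {v | ∀ x, HasSum (fun y => ρ x y * v y) ((μ : ℂ) * v x)}
  add_mem' := by
    intro v w hv hw x
    simpa [mul_add] using (hv x).add (hw x)
  zero_mem' := by
    intro x
    simp
  smul_mem' := by
    intro c v hv x
    simpa [mul_left_comm] using (hv x).mul_left c

/-- Von Neumann entropy `-∑ μ log μ`, over the eigenvalues counted with multiplicity. -/
def entropy (ρ : Matrix Y Y ℂ) : ℝ≥0∞ :=
  ∑' μ : ℝ, (Module.finrank ℂ (eigenspace ρ μ) : ℝ≥0∞) * ENNReal.ofReal (Real.negMulLog μ)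

/-- A self-adjoint realisation `∑ α, E α |b α⟩⟨b α|` of the matrix `A`, with ground state
energy zero and with `exp (-A / T)` of finite trace for all `T > 0`.
(Self-adjoint operators `A ≥ 0` with `tr (exp (-A / T)) < ∞` are exactly those of this form.) -/
structure GibbsSpectrum (A : Matrix Y Y ℂ) (ι : Type*) where
  /-- orthonormal basis of eigenvectors -/
  basis : HilbertBasis ι ℂ ℓ²(Y, ℂ)
  /-- eigenvalues -/
  energy : ι → ℝ
  energy_nonneg : ∀ α, 0 ≤ energy α
  exists_ground : ∃ α, energy α = 0
  matrix_eq : ∀ x y,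
    HasSum (fun α => (energy α : ℂ) * (basis α : ℓ²(Y, ℂ)) x * star ((basis α : ℓ²(Y, ℂ)) y))
      (A x y)
  summable_exp : ∀ T : ℝ, 0 < T → Summable fun α => Real.exp (-energy α / T)

namespace GibbsSpectrum

variable {A : Matrix Y Y ℂ} {ι : Type*} (G : GibbsSpectrum A ι)

/-- The partition function. -/
def partitionFunction (T : ℝ) : ℝ := ∑' α, Real.exp (-G.energy α / T)

open Classical in
/-- The eigenvalue at `basis α` of the thermal state `ρ_T = exp (-A / T) / Z_T`; at `T = 0`
of its limit, the maximally mixed state on the ground space. -/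
def weight (T : ℝ) (α : ι) : ℝ :=
  if T = 0 then
    if G.energy α = 0 then 1 / (Nat.card {β // G.energy β = 0} : ℝ) else 0
  else Real.exp (-G.energy α / T) / G.partitionFunction T

/-- Energy density `tr (A ρ_T) / vol`. -/
def energyDensity (vol : ℝ) (T : ℝ) : ℝ := (∑' α, G.energy α * G.weight T α) / vol

/-- Entropy density `S (ρ_T) / vol`. -/
def entropyDensity (vol : ℝ) (T : ℝ) : ℝ := (∑' α, Real.negMulLog (G.weight T α)) / vol

/-- Specific heat capacity, the derivative of the energy density in the temperature. -/
def specificHeat (vol : ℝ) (T : ℝ) : ℝ := deriv (G.energyDensity vol) T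

end GibbsSpectrum

end Matrices

/-! ### Tensor products over sites -/

section Tensor

variable {Λ : Type*} {X : Λ → Type*}

/-- Basis labels of the tensor product over the sites in `S`, where `X j` labels an orthonormal
basis of the Hilbert space of site `j`. -/
abbrev Config (X : Λ → Type*) (S : Set Λ) : Type _ := (j : S) → X j

/-- Restriction of a global configuration to `S`. -/
def restr (S : Set Λ) (x : (j : Λ) → X j) : Config X S := fun j => x j

open Classical in
/-- The configuration equal to `a` on `S` and to `z` off `S`. -/
def glue (S : Set Λ) (a : Config X S) (z : Config X Sᶜ) : (j : Λ) → X j :=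
  fun j => if h : j ∈ S then a ⟨j, h⟩ else z ⟨j, h⟩

open Classical in
/-- `A ⊗ 1` for an observable `A` on the sites in `S`. -/
def extend (S : Set Λ) (A : Matrix (Config X S) (Config X S) ℂ) :
    Matrix ((j : Λ) → X j) ((j : Λ) → X j) ℂ :=
  fun x y => if ∀ j, j ∉ S → x j = y j then A (restr S x) (restr S y) else 0

/-- The reduced state `ρ_S`: partial trace over all sites outside `S`. -/
def reduced (S : Set Λ) (ρ : Matrix ((j : Λ) → X j) ((j : Λ) → X j) ℂ) :
    Matrix (Config X S) (Config X S) ℂ :=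
  fun a b => ∑' z : Config X Sᶜ, ρ (glue S a z) (glue S b z)

/-- `⨂ m, ρ_{R m}` for a finite partition of the sites into regions `R m`. -/
def productState {M : Type*} [Fintype M] (R : M → Set Λ)
    (ρ : Matrix ((j : Λ) → X j) ((j : Λ) → X j) ℂ) :
    Matrix ((j : Λ) → X j) ((j : Λ) → X j) ℂ :=
  fun x y => ∏ m, reduced (R m) ρ (restr (R m) x) (restr (R m) y)

end Tensor

/-! ### The cubic lattice -/

section Lattice

variable {d n : ℕ}

/-- The cubic lattice, with coordinates running from `0` to `n - 1`. -/
abbrev Site (d n : ℕ) : Type := Fin d → Fin n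

/-- Ball of radius `r` in the Manhattan distance. -/
def ball (r : ℕ) (i : Site d n) : Set (Site d n) :=
  {j | ∑ a, |((i a : ℕ) : ℤ) - ((j a : ℕ) : ℤ)| ≤ (r : ℤ)}

/-- Labels of the cubes of edge length `l` that tile the lattice when `l ∣ n`. -/
abbrev CubeLabel (d n l : ℕ) : Type := Fin d → Fin (n / l)

/-- The cube with label `m`. -/
def cube (l : ℕ) (m : CubeLabel d n l) : Set (Site d n) :=
  {i | ∀ a, (i a : ℕ) / l = (m a : ℕ)}

/-- The boundary of width `r` of a cube: its sites at which some coordinate is among the first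
`r` or the last `r` values in the cube. -/
def cubeBoundary (l r : ℕ) (m : CubeLabel d n l) : Set (Site d n) :=
  {i | i ∈ cube l m ∧ ¬ ∀ a, r ≤ (i a : ℕ) % l ∧ (i a : ℕ) % l + r < l}

/-- The terms `H_{B_r(i)}` of an `r`-local Hamiltonian. -/
structure LocalHamiltonian (r : ℕ) (X : Site d n → Type*) where
  /-- the term at `i`, acting on the ball around `i` -/
  term : (i : Site d n) → Matrix (Config X (ball r i)) (Config X (ball r i)) ℂ
  isHermitian : ∀ i, (term i).IsHermitian

namespace LocalHamiltonian

variable {r : ℕ} {X : Site d n → Type*} (H : LocalHamiltonian r X)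

/-- The term at `i` as an observable of the whole lattice. -/
def globalTerm (i : Site d n) : Matrix ((j : Site d n) → X j) ((j : Site d n) → X j) ℂ :=
  extend (ball r i) (H.term i)

/-- The matrix of the Hamiltonian `∑ i, H_{B_r(i)}`. -/
def total : Matrix ((j : Site d n) → X j) ((j : Site d n) → X j) ℂ :=
  ∑ i, H.globalTerm i

/-- The correlation in `σ` of the term at `i` between the cubes of the tiling,
`tr (H_{B_r(i)} (σ - ⨂ m, σ_{R m}))`. If the ball around `i` meets two cubes, in `A` and `B`, and
`H_{B_r(i)} = ∑ k, h_A k ⊗ h_B k`, this is `∑ k, Cov_σ ((h_A k)†, h_B k)`. -/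
def correlation (l : ℕ) (σ : Matrix ((j : Site d n) → X j) ((j : Site d n) → X j) ℂ)
    (i : Site d n) : ℂ :=
  expect (H.globalTerm i) σ - expect (H.globalTerm i) (productState (cube (n := n) l) σ)

/-- The interaction strength `h(σ)`: the smaller of the largest norm of a term and the largest
correlation of a term at a boundary site of a cube. -/
def strength (l : ℕ) (σ : Matrix ((j : Site d n) → X j) ((j : Site d n) → X j) ℂ) : ℝ :=
  (min (⨆ i, opNorm (H.term i))
    (⨆ (m : CubeLabel d n l) (i ∈ cubeBoundary l r m), ‖H.correlation l σ i‖ₑ)).toReal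

end LocalHamiltonian

/-- The average of `S (σ_R)` over the cubes `R` of the tiling. -/
def meanCubeEntropy {X : Site d n → Type*} (l : ℕ)
    (σ : Matrix ((j : Site d n) → X j) ((j : Site d n) → X j) ℂ) : ℝ≥0∞ :=
  (∑ m : CubeLabel d n l, entropy (reduced (cube l m) σ)) / (Fintype.card (CubeLabel d n l) : ℝ≥0∞)

end Lattice

end AreaLaw

end

/-! # The area law from the thermodynamics of local Hamiltonians -/

namespace AreaLaw

/-! ### Thermodynamics of a Gibbs spectrum -/

namespace GibbsSpectrum

variable {Y ι : Type*} {A : Matrix Y Y ℂ} (G : GibbsSpectrum A ι)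

/-! The area law is the Gibbs variational principle applied to the product state `σ̃ = ⨂ σ_{R_m}`.
For every `T > 0` it gives `S(σ̃) ≤ tr(H σ̃) / T + log Z_T`, and the left side is the sum of the
cube entropies. Passing from `σ` to `σ̃` changes the energy only through terms centred in the
boundary of a cube, because a ball inside one cube sees the same reduced state in both. There are at
most `2 d r n ^ d / l` such sites and each costs at most `2 h(σ)`, so `σ̃` has energy density at
most `u_c = (C + 4 d r h(σ)) / l`. Dividing by the number of cubes, `E[S(σ_R)] ≤ l ^ d (u_c / T +
log Z_T / n ^ d)`; this is `meanCubeEntropy_le`.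

The rest is thermodynamics. As `T → 0`, `log Z_T / n ^ d` tends to `s(0)` and `u` tends to `0`;
their derivatives are `u / T ^ 2` and `c`. Hence a bound on `c`, integrated twice, bounds `log Z_T`.
The temperature is still free: it is chosen explicitly from the bound on `c`, and `u(T_c) = u_c`
forces it to be at most `T_c`, so that the hypothesis on `c` covers the whole range of integration
(`exists_temperature_of_rpow_bound`, `exists_temperature_of_gap_bound`).

Infinite-dimensional sites and unbounded terms need care in two places. A density matrix is shown to
define a compact self-adjoint operator, which yields a spectral decomposition. The variational
principle (`tsum_negMulLog_le`) is a double sum in `ℝ≥0∞` arranged so that nothing is subtracted;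
finiteness of the entropy is then a conclusion, and operator domains never enter. -/

theorem pow_mul_exp_le (k : ℕ) {T : ℝ} (hT : 0 < T) (α : ι) :
    G.energy α ^ k * Real.exp (-G.energy α / T) ≤
      k.factorial * (2 * T) ^ k * Real.exp (-G.energy α / (2 * T)) := by
  -- Half of the exponent is spent on absorbing the power, through a single term of the exponential
  -- series.
  have h := Real.pow_div_factorial_le_exp (G.energy α / (2 * T))
    (div_nonneg (G.energy_nonneg α) (by positivity)) k
  rw [div_pow, div_div, div_le_iff₀ (by positivity)] at h
  have e : Real.exp (-G.energy α / T) =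
      Real.exp (-G.energy α / (2 * T)) * Real.exp (-G.energy α / (2 * T)) := by
    rw [← Real.exp_add]; congr 1; field_simp; ring
  have e2 : Real.exp (G.energy α / (2 * T)) * Real.exp (-G.energy α / (2 * T)) = 1 := by
    rw [← Real.exp_add, ← Real.exp_zero]; congr 1; ring
  calc G.energy α ^ k * Real.exp (-G.energy α / T)
      ≤ (Real.exp (G.energy α / (2 * T)) * ((2 * T) ^ k * k.factorial)) *
          Real.exp (-G.energy α / T) := by gcongr
    _ = k.factorial * (2 * T) ^ k * (Real.exp (G.energy α / (2 * T)) *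
          Real.exp (-G.energy α / (2 * T))) * Real.exp (-G.energy α / (2 * T)) := by
        rw [e]; ring
    _ = _ := by rw [e2, mul_one]

theorem summable_pow_mul_exp (k : ℕ) {T : ℝ} (hT : 0 < T) :
    Summable fun α => G.energy α ^ k * Real.exp (-G.energy α / T) :=
  Summable.of_nonneg_of_le
    (fun α => mul_nonneg (pow_nonneg (G.energy_nonneg α) k) (Real.exp_pos _).le)
    (fun α => G.pow_mul_exp_le k hT α)
    ((G.summable_exp (2 * T) (by positivity)).mul_left _)

theorem hasDerivAt_tsum_pow_mul_exp (k : ℕ) {T : ℝ} (hT : 0 < T) :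
    HasDerivAt (fun t => ∑' α, G.energy α ^ k * Real.exp (-G.energy α / t))
      ((∑' α, G.energy α ^ (k + 1) * Real.exp (-G.energy α / T)) / T ^ 2) T := by
  have hder : ∀ α, ∀ t ∈ Set.Ioo (T / 2) (2 * T),
      HasDerivAt (fun t => G.energy α ^ k * Real.exp (-G.energy α / t))
        (G.energy α ^ (k + 1) * Real.exp (-G.energy α / t) / t ^ 2) t := by
    intro α t ht
    have ht0 : t ≠ 0 := by have := ht.1; exact ((half_pos hT).trans this).ne'
    have h1 : HasDerivAt (fun t : ℝ => -G.energy α / t) (G.energy α / t ^ 2) t := by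
      simpa [div_eq_mul_inv] using (hasDerivAt_inv ht0).const_mul (-G.energy α)
    exact (h1.exp.const_mul (G.energy α ^ k)).congr_deriv (by ring)
  have hmem : T ∈ Set.Ioo (T / 2) (2 * T) := ⟨by linarith, by linarith⟩
  -- On `(T / 2, 2 T)` the termwise derivatives are dominated by taking the exponential at `2 T` and
  -- `1 / t ^ 2` at `T / 2`.
  have := hasDerivAt_tsum_of_isPreconnected
    (u := fun α => G.energy α ^ (k + 1) * Real.exp (-G.energy α / (2 * T)) / (T / 2) ^ 2)
    ((G.summable_pow_mul_exp (k + 1) (by positivity : 0 < 2 * T)).div_const _)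
    isOpen_Ioo isPreconnected_Ioo hder (fun α t ht => ?_) hmem
    (G.summable_pow_mul_exp k hT) hmem
  · rwa [tsum_div_const] at this
  · have ht0 : 0 < t := by have := ht.1; linarith
    have hE := G.energy_nonneg α
    rw [Real.norm_of_nonneg (by positivity)]
    have h2 : -G.energy α / t ≤ -G.energy α / (2 * T) := by
      rw [neg_div, neg_div, neg_le_neg_iff]
      exact div_le_div_of_nonneg_left hE ht0 ht.2.le
    gcongr
    exact ht.1.le

theorem one_le_partitionFunction {T : ℝ} (hT : 0 < T) : 1 ≤ G.partitionFunction T := by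
  obtain ⟨α, hα⟩ := G.exists_ground
  have := (G.summable_exp T hT).le_tsum α (fun _ _ => (Real.exp_pos _).le)
  simpa [hα, partitionFunction] using this

theorem partitionFunction_pos {T : ℝ} (hT : 0 < T) : 0 < G.partitionFunction T :=
  one_pos.trans_le (G.one_le_partitionFunction hT)

theorem energyDensity_eq (vol : ℝ) {T : ℝ} (hT : 0 < T) :
    G.energyDensity vol T =
      (∑' α, G.energy α ^ 1 * Real.exp (-G.energy α / T)) / G.partitionFunction T / vol := by
  simp only [energyDensity, weight, hT.ne', if_false, pow_one, ← tsum_div_const, mul_div_assoc]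

theorem hasDerivAt_partitionFunction {T : ℝ} (hT : 0 < T) :
    HasDerivAt G.partitionFunction
      ((∑' α, G.energy α ^ 1 * Real.exp (-G.energy α / T)) / T ^ 2) T := by
  simpa [partitionFunction] using! G.hasDerivAt_tsum_pow_mul_exp 0 hT

theorem differentiableAt_energyDensity (vol : ℝ) {T : ℝ} (hT : 0 < T) :
    DifferentiableAt ℝ (G.energyDensity vol) T := by
  have h := (((G.hasDerivAt_tsum_pow_mul_exp 1 hT).div (G.hasDerivAt_partitionFunction hT)
    (G.partitionFunction_pos hT).ne').div_const vol).differentiableAt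
  refine h.congr_of_eventuallyEq ?_
  filter_upwards [lt_mem_nhds hT] with t ht
  exact G.energyDensity_eq vol ht

theorem hasDerivAt_log_partitionFunction (vol : ℝ) {T : ℝ} (hT : 0 < T) :
    HasDerivAt (fun t => Real.log (G.partitionFunction t) / vol)
      (G.energyDensity vol T / T ^ 2) T := by
  have h := ((G.hasDerivAt_partitionFunction hT).log
    (G.partitionFunction_pos hT).ne').div_const vol
  rwa [div_right_comm _ (T ^ 2), div_right_comm _ (T ^ 2), ← G.energyDensity_eq vol hT] at h

/-! ### Limits as the temperature tends to zero -/

theorem tendsto_exp_energy (α : ι) :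
    Tendsto (fun t => Real.exp (-G.energy α / t)) (𝓝[>] 0)
      (𝓝 ({β | G.energy β = 0}.indicator (fun _ => (1 : ℝ)) α)) := by
  by_cases h : G.energy α = 0
  · simp [h]
  · have hpos : 0 < G.energy α := lt_of_le_of_ne (G.energy_nonneg α) (Ne.symm h)
    rw [Set.indicator_of_notMem (by simpa using h)]
    apply Real.tendsto_exp_atBot.comp
    have := (tendsto_inv_nhdsGT_zero (𝕜 := ℝ)).const_mul_atTop_of_neg (neg_lt_zero.2 hpos)
    exact this.congr fun t => (div_eq_mul_inv _ _).symm

theorem exp_energy_le (α : ι) {t : ℝ} (h0 : 0 < t) (h1 : t ≤ 1) :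
    Real.exp (-G.energy α / t) ≤ Real.exp (-G.energy α / 1) := by
  have hE := G.energy_nonneg α
  apply Real.exp_le_exp.2
  rw [neg_div, neg_div, neg_le_neg_iff]
  exact div_le_div_of_nonneg_left hE h0 h1

/-- Each ground level contributes `1` to the convergent sum `Z_1`. -/
theorem finite_ground : {α | G.energy α = 0}.Finite := by
  have h := (G.summable_exp 1 one_pos).tendsto_cofinite_zero
  have h2 := h.eventually (gt_mem_nhds (one_pos : (0 : ℝ) < 1))
  rw [Filter.eventually_cofinite] at h2
  refine h2.subset fun α hα => ?_
  have : G.energy α = 0 := hα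
  simp [this]

theorem card_ground_ne_zero : (Nat.card {β // G.energy β = 0} : ℝ) ≠ 0 := by
  have : Finite {β // G.energy β = 0} := G.finite_ground
  have : Nonempty {β // G.energy β = 0} := by
    obtain ⟨α, hα⟩ := G.exists_ground
    exact ⟨⟨α, hα⟩⟩
  exact_mod_cast Nat.card_pos.ne'

theorem tendsto_partitionFunction :
    Tendsto G.partitionFunction (𝓝[>] 0) (𝓝 (Nat.card {β // G.energy β = 0} : ℝ)) := by
  have key : ∑' α, {β | G.energy β = 0}.indicator (fun _ => (1 : ℝ)) α =
      (Nat.card {β // G.energy β = 0} : ℝ) := by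
    let _ : Fintype {β | G.energy β = 0} := G.finite_ground.fintype
    rw [← tsum_subtype, tsum_fintype, Finset.sum_const, nsmul_eq_mul, Finset.card_univ,
      ← Nat.card_eq_fintype_card, mul_one]
    rfl
  rw [← key]
  refine tendsto_tsum_of_dominated_convergence (G.summable_exp 1 one_pos)
    (fun α => G.tendsto_exp_energy α) ?_
  filter_upwards [Ioc_mem_nhdsGT (one_pos : (0 : ℝ) < 1)] with t ht α
  rw [Real.norm_of_nonneg (Real.exp_pos _).le]
  exact G.exp_energy_le α ht.1 ht.2

theorem tendsto_energyDensity (vol : ℝ) :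
    Tendsto (G.energyDensity vol) (𝓝[>] 0) (𝓝 0) := by
  have h1 : Tendsto (fun t => ∑' α, G.energy α ^ 1 * Real.exp (-G.energy α / t)) (𝓝[>] 0)
      (𝓝 (∑' _ : ι, (0 : ℝ))) := by
    refine tendsto_tsum_of_dominated_convergence (G.summable_pow_mul_exp 1 one_pos)
      (fun α => ?_) ?_
    · have := (G.tendsto_exp_energy α).const_mul (G.energy α ^ 1)
      convert this using 2
      by_cases h : G.energy α = 0 <;> simp [h]
    · filter_upwards [Ioc_mem_nhdsGT (one_pos : (0 : ℝ) < 1)] with t ht α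
      have hE := G.energy_nonneg α
      rw [Real.norm_of_nonneg (by positivity)]
      exact mul_le_mul_of_nonneg_left (G.exp_energy_le α ht.1 ht.2) (by positivity)
  have h2 := (h1.div G.tendsto_partitionFunction G.card_ground_ne_zero).div_const vol
  simp only [tsum_zero, zero_div] at h2
  refine h2.congr' ?_
  filter_upwards [self_mem_nhdsWithin] with t ht
  exact (G.energyDensity_eq vol ht).symm

theorem entropyDensity_zero (vol : ℝ) :
    G.entropyDensity vol 0 = Real.log (Nat.card {β // G.energy β = 0} : ℝ) / vol := by
  have hg := G.card_ground_ne_zero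
  set g : ℝ := (Nat.card {β // G.energy β = 0} : ℝ) with hgdef
  have hw : ∀ α, Real.negMulLog (G.weight 0 α) =
      {β | G.energy β = 0}.indicator (fun _ => Real.negMulLog (1 / g)) α := by
    intro α
    by_cases h : G.energy α = 0 <;> simp [weight, h, hgdef]
  let _ : Fintype {β | G.energy β = 0} := G.finite_ground.fintype
  have hc : (Fintype.card {β | G.energy β = 0} : ℝ) = g := by
    rw [← Nat.card_eq_fintype_card]; rfl
  rw [entropyDensity]
  congr 1
  simp only [hw]
  rw [← tsum_subtype, tsum_fintype, Finset.sum_const, nsmul_eq_mul, Finset.card_univ, hc]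
  simp [Real.negMulLog]
  field_simp

/-- Both sides are the logarithm of the ground state degeneracy per volume. This fixes the
integration constant when `u / T ^ 2` is integrated from zero temperature. -/
theorem tendsto_log_partitionFunction (vol : ℝ) :
    Tendsto (fun t => Real.log (G.partitionFunction t) / vol) (𝓝[>] 0)
      (𝓝 (G.entropyDensity vol 0)) := by
  rw [G.entropyDensity_zero]
  exact (G.tendsto_partitionFunction.log G.card_ground_ne_zero).div_const vol

end GibbsSpectrum

/-- A function on `(0, b]` that vanishes at `0` and has nonpositive derivative is nonpositive. -/
theorem nonpos_of_deriv_nonpos {f f' : ℝ → ℝ} {b : ℝ} (hb : 0 < b)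
    (hf : ∀ t, 0 < t → t ≤ b → HasDerivAt f (f' t) t) (hf' : ∀ t, 0 < t → t ≤ b → f' t ≤ 0)
    (h0 : Tendsto f (𝓝[>] 0) (𝓝 0)) : f b ≤ 0 := by
  have hanti : AntitoneOn f (Set.Ioc 0 b) := by
    refine antitoneOn_of_deriv_nonpos (convex_Ioc 0 b)
      (fun t ht => (hf t ht.1 ht.2).continuousAt.continuousWithinAt) ?_ ?_
    · intro t ht
      rw [interior_Ioc] at ht
      exact (hf t ht.1 ht.2.le).differentiableAt.differentiableWithinAt
    · intro t ht
      rw [interior_Ioc] at ht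
      rw [(hf t ht.1 ht.2.le).deriv]
      exact hf' t ht.1 ht.2.le
  refine ge_of_tendsto h0 ?_
  filter_upwards [Ioc_mem_nhdsGT hb] with t ht
  exact hanti ht ⟨hb, le_rfl⟩ ht.2

/-- Comparing antiderivatives replaces integration, so no integrability of the derivatives near `0`
has to be checked. -/
theorem le_of_hasDerivAt_le {f g f' g' : ℝ → ℝ} {a b : ℝ} (hb : 0 < b)
    (hf : ∀ t, 0 < t → t ≤ b → HasDerivAt f (f' t) t)
    (hg : ∀ t, 0 < t → t ≤ b → HasDerivAt g (g' t) t)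
    (hfg : ∀ t, 0 < t → t ≤ b → f' t ≤ g' t)
    (hf0 : Tendsto f (𝓝[>] 0) (𝓝 a)) (hg0 : Tendsto g (𝓝[>] 0) (𝓝 0)) : f b ≤ a + g b := by
  have := nonpos_of_deriv_nonpos (f := fun t => f t - g t - a) (f' := fun t => f' t - g' t) hb
    (fun t h1 h2 => ((hf t h1 h2).sub (hg t h1 h2)).sub_const a)
    (fun t h1 h2 => sub_nonpos.2 (hfg t h1 h2))
    (by simpa using (hf0.sub hg0).sub_const a)
  linarith

/-- `t ^ γ * exp (-t) ≤ γ ^ γ * exp (-(t - γ) / 2)`. -/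
theorem rpow_mul_exp_neg_le {t γ : ℝ} (ht : 0 < t) (hγ : 0 < γ) :
    t ^ γ * Real.exp (-t) ≤ γ ^ γ * Real.exp ((γ - t) / 2) := by
  -- The tangent to `log` at `2` gives `log y ≤ y / 2 - 1 + log 2`; slope `1 / 2` is what leaves
  -- half of the decay `exp (-t)` in the bound.
  have hlog : Real.log (t / γ) ≤ (t / γ + 1) / 2 := by
    have h1 := Real.log_le_sub_one_of_pos (show 0 < t / γ / 2 by positivity)
    rw [Real.log_div (by positivity) two_ne_zero] at h1
    have := Real.log_two_lt_d9
    linarith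
  rw [Real.log_div ht.ne' hγ.ne'] at hlog
  have h2 : γ * (Real.log t - Real.log γ) ≤ γ * ((t / γ + 1) / 2) := by gcongr
  have h3 : γ * ((t / γ + 1) / 2) = (t + γ) / 2 := by field_simp
  rw [Real.rpow_def_of_pos ht, Real.rpow_def_of_pos hγ, ← Real.exp_add, ← Real.exp_add]
  apply Real.exp_le_exp.2
  linarith

/-! ### Free energy bounds from specific heat bounds -/

namespace GibbsSpectrum

variable {Y ι : Type*} {A : Matrix Y Y ℂ} (G : GibbsSpectrum A ι) {vol Tc uc k γ Δ : ℝ}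

theorem energyDensity_le_of_specificHeat_le {g g' : ℝ → ℝ}
    (hg : ∀ t, 0 < t → t ≤ Tc → HasDerivAt g (g' t) t)
    (hg0 : Tendsto g (𝓝[>] 0) (𝓝 0))
    (hc : ∀ t, 0 < t → t ≤ Tc → G.specificHeat vol t ≤ g' t) :
    ∀ t, 0 < t → t ≤ Tc → G.energyDensity vol t ≤ g t := by
  intro t h0 h1
  simpa using le_of_hasDerivAt_le h0
    (fun s hs _ => (G.differentiableAt_energyDensity vol hs).hasDerivAt)
    (fun s hs h => hg s hs (h.trans h1)) (fun s hs h => hc s hs (h.trans h1))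
    (G.tendsto_energyDensity vol) hg0

theorem log_partitionFunction_le {T : ℝ} {g g' : ℝ → ℝ} (hT : 0 < T)
    (hg : ∀ t, 0 < t → t ≤ T → HasDerivAt g (g' t) t)
    (hg0 : Tendsto g (𝓝[>] 0) (𝓝 0))
    (hu : ∀ t, 0 < t → t ≤ T → G.energyDensity vol t / t ^ 2 ≤ g' t) :
    Real.log (G.partitionFunction T) / vol ≤ G.entropyDensity vol 0 + g T :=
  le_of_hasDerivAt_le (f := fun t => Real.log (G.partitionFunction t) / vol) hT
    (fun _ hs _ => G.hasDerivAt_log_partitionFunction vol hs)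
    hg hu (G.tendsto_log_partitionFunction vol) hg0

/-- If the specific heat is at most `k (T / Δ) ^ γ`, the free energy at a suitable temperature
bounds the entropy at energy density `uc`. -/
theorem exists_temperature_of_rpow_bound (hTc : 0 < Tc) (huc : 0 < uc)
    (hu : G.energyDensity vol Tc = uc) (hk : 0 < k) (hγ : 0 < γ) (hΔ : 0 < Δ)
    (hc : ∀ T, 0 < T → T ≤ Tc → G.specificHeat vol T ≤ k * (T / Δ) ^ γ) :
    ∃ T, 0 < T ∧ uc / T + Real.log (G.partitionFunction T) / vol ≤ G.entropyDensity vol 0 +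
      k ^ (1 / (γ + 1)) / γ * (γ + 1) ^ (γ / (γ + 1)) * (uc / Δ) ^ (γ / (γ + 1)) := by
  have hγ1 : 0 < γ + 1 := by linarith
  have hder : ∀ c e t : ℝ, 0 < t →
      HasDerivAt (fun t => c * (t / Δ) ^ e) (c * (1 / Δ * e * (t / Δ) ^ (e - 1))) t := by
    intro c e t ht
    exact (((hasDerivAt_id t).div_const Δ).rpow_const (Or.inl (div_pos ht hΔ).ne')).const_mul c
  have hlim : ∀ c e : ℝ, 0 < e → Tendsto (fun t => c * (t / Δ) ^ e) (𝓝[>] 0) (𝓝 0) := by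
    intro c e he
    have : ContinuousAt (fun t : ℝ => c * (t / Δ) ^ e) 0 :=
      ((continuousAt_id.div_const Δ).rpow_const (Or.inr he.le)).const_mul c
    have h := this.tendsto.mono_left (nhdsWithin_le_nhds (s := Set.Ioi 0))
    simpa [Real.zero_rpow he.ne'] using h
  have hule := G.energyDensity_le_of_specificHeat_le (vol := vol)
    (g := fun t => k * Δ / (γ + 1) * (t / Δ) ^ (γ + 1))
    (fun t ht _ => hder _ _ t ht) (hlim _ _ hγ1) (fun t ht h => by
      refine (hc t ht h).trans_eq ?_
      rw [add_sub_cancel_right]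
      field_simp)
  -- The integrated bound on `u` equals `uc` at the temperature `Δ * τ`.
  set τ : ℝ := ((γ + 1) * (uc / Δ) / k) ^ (1 / (γ + 1)) with hτ
  have hbase : 0 < (γ + 1) * (uc / Δ) / k := by positivity
  have hτ0 : 0 < τ := Real.rpow_pos_of_pos hbase _
  have hτ1 : τ ^ (γ + 1) = (γ + 1) * (uc / Δ) / k := by
    rw [hτ, ← Real.rpow_mul hbase.le, one_div_mul_cancel hγ1.ne', Real.rpow_one]
  have hτγ : τ ^ (γ + 1) = τ ^ γ * τ := Real.rpow_add_one hτ0.ne' γ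
  have huτ : uc = k * Δ / (γ + 1) * τ ^ (γ + 1) := by rw [hτ1]; field_simp
  -- At `Tc` the energy density is `uc`, so the increasing bound on it has already reached `uc`
  -- there.
  have hTle : Δ * τ ≤ Tc := by
    have h := hule Tc hTc le_rfl
    rw [hu, huτ] at h
    have h2 := le_of_mul_le_mul_left h (by positivity)
    rw [Real.rpow_le_rpow_iff hτ0.le (by positivity) hγ1, le_div_iff₀ hΔ] at h2
    linarith
  have hT0 : 0 < Δ * τ := by positivity
  refine ⟨Δ * τ, hT0, ?_⟩
  have hL := G.log_partitionFunction_le (vol := vol)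
    (g := fun t => k / (γ * (γ + 1)) * (t / Δ) ^ γ) hT0
    (fun t ht _ => hder _ _ t ht) (hlim _ _ hγ) (fun t ht h => by
      have h1 := hule t ht (h.trans hTle)
      rw [div_le_iff₀ (by positivity)]
      refine h1.trans_eq ?_
      have e1 : (t / Δ) ^ (γ + 1) = (t / Δ) ^ (γ - 1) * (t / Δ) ^ 2 := by
        rw [← Real.rpow_natCast, ← Real.rpow_add (by positivity)]
        congr 1
        push_cast; ring
      rw [e1]
      field_simp)
  simp only [mul_div_cancel_left₀ _ hΔ.ne'] at hL
  have e1 : uc / (Δ * τ) = k / (γ + 1) * τ ^ γ := by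
    rw [huτ, hτγ]; field_simp
  have e2 : k ^ (1 / (γ + 1)) / γ * (γ + 1) ^ (γ / (γ + 1)) * (uc / Δ) ^ (γ / (γ + 1)) =
      k / γ * τ ^ γ := by
    rw [hτ, ← Real.rpow_mul hbase.le, one_div_mul_eq_div,
      Real.div_rpow (by positivity) hk.le, Real.mul_rpow hγ1.le (by positivity)]
    have : k = k ^ (1 / (γ + 1)) * k ^ (γ / (γ + 1)) := by
      rw [← Real.rpow_add hk, ← add_div, add_comm, div_self hγ1.ne', Real.rpow_one]
    have h0 : k ^ (γ / (γ + 1)) ≠ 0 := (Real.rpow_pos_of_pos hk _).ne'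
    rw [show k / γ = k ^ (1 / (γ + 1)) * k ^ (γ / (γ + 1)) / γ by rw [← this]]
    field_simp
  rw [e1, e2]
  have e3 : k / (γ + 1) * τ ^ γ + k / (γ * (γ + 1)) * τ ^ γ = k / γ * τ ^ γ := by
    field_simp
    try ring
  linarith

/-- If the specific heat is at most `k (Δ / T) ^ γ exp (-Δ / T)`, the free energy at a suitable
temperature bounds the entropy at energy density `uc`. -/
theorem exists_temperature_of_gap_bound {L : ℝ} (hTc : 0 < Tc) (hL : 0 < L) (huc : 1 / L ≤ uc)
    (hu : G.energyDensity vol Tc = uc) (hk : 0 < k) (hγ : 0 < γ) (hΔ : 0 < Δ)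
    (hc : ∀ T, 0 < T → T ≤ Tc →
      G.specificHeat vol T ≤ k * (Δ / T) ^ γ * Real.exp (-(Δ / T))) :
    ∃ T, 0 < T ∧ uc / T + Real.log (G.partitionFunction T) / vol ≤ G.entropyDensity vol 0 +
      2 * (max 0 (Real.log (k * Δ * γ ^ (γ - 1)) + Real.log L) + 1 + γ / 2) * (uc / Δ) := by
  -- The constants are chosen so that the hypothesis becomes `c ≤ B exp ((x - Δ / t) / 2)`: `exp a`
  -- absorbs `k Δ γ ^ (γ - 1) L`, and `B = γ / (Δ L)` takes the remaining prefactor. The exponential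
  -- is at most `1` exactly for `t ≤ Δ / x`, the temperature used in the end.
  set a := max 0 (Real.log (k * Δ * γ ^ (γ - 1)) + Real.log L) with ha
  have ha0 : 0 ≤ a := le_max_left _ _
  have hγγ : 0 < γ ^ (γ - 1) := Real.rpow_pos_of_pos hγ _
  have hka : k * Δ * γ ^ (γ - 1) * L ≤ Real.exp a := by
    rw [← Real.log_le_iff_le_exp (by positivity), Real.log_mul (by positivity) hL.ne']
    exact le_max_right _ _
  set x := 2 * a + γ with hx
  have hx0 : 0 < x := by positivity
  set B := γ / (Δ * L) with hB
  have hB0 : 0 < B := by positivity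
  have hcB : ∀ t, 0 < t → t ≤ Tc → G.specificHeat vol t ≤ B * Real.exp ((x - Δ / t) / 2) := by
    intro t ht h
    have h1 := rpow_mul_exp_neg_le (div_pos hΔ ht) hγ
    have h2 : γ ^ γ = γ ^ (γ - 1) * γ := by
      rw [← Real.rpow_add_one hγ.ne', sub_add_cancel]
    calc G.specificHeat vol t ≤ k * ((Δ / t) ^ γ * Real.exp (-(Δ / t))) := by
          rw [← mul_assoc]; exact hc t ht h
      _ ≤ k * (γ ^ γ * Real.exp ((γ - Δ / t) / 2)) := by gcongr
      _ = (k * Δ * γ ^ (γ - 1) * L) * B * Real.exp ((γ - Δ / t) / 2) := by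
          rw [h2, hB]; field_simp
      _ ≤ Real.exp a * B * Real.exp ((γ - Δ / t) / 2) := by gcongr
      _ = B * (Real.exp a * Real.exp ((γ - Δ / t) / 2)) := by ring
      _ = _ := by
          rw [← Real.exp_add, hx]; congr 2; ring
  have hlin : ∀ c : ℝ, Tendsto (fun t => c * t) (𝓝[>] (0 : ℝ)) (𝓝 0) := by
    intro c
    have : Continuous fun t : ℝ => c * t := by fun_prop
    simpa using (this.tendsto 0).mono_left (nhdsWithin_le_nhds (s := Set.Ioi 0))
  have hexp1 : ∀ t, 0 < t → t ≤ Δ / x → Real.exp ((x - Δ / t) / 2) ≤ 1 := by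
    intro t ht h
    rw [Real.exp_le_one_iff]
    have : x ≤ Δ / t := by
      rw [le_div_iff₀ ht, mul_comm]; exact (le_div_iff₀ hx0).1 h
    linarith
  -- Otherwise `c ≤ B` up to `Tc`, so `u(Tc) ≤ B Tc < B Δ / x = γ / (x L) ≤ 1 / L ≤ uc`. This is the
  -- first use of the lower bound on `uc`.
  have hTle : Δ / x ≤ Tc := by
    by_contra! hlt
    have h1 := G.energyDensity_le_of_specificHeat_le (vol := vol) (g := fun t => B * t)
      (g' := fun _ => B)
      (fun t _ _ => by simpa using (hasDerivAt_id t).const_mul B) (hlin B)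
      (fun t ht h => (hcB t ht h).trans
        (mul_le_of_le_one_right hB0.le (hexp1 t ht (h.trans hlt.le)))) Tc hTc le_rfl
    have h2 : B * Tc < B * (Δ / x) := by gcongr
    have h3 : B * (Δ / x) ≤ 1 / L := by
      have : B * (Δ / x) = γ / x * (1 / L) := by rw [hB]; field_simp
      rw [this]
      refine mul_le_of_le_one_left (by positivity) ?_
      rw [div_le_one hx0]; linarith
    rw [hu] at h1
    linarith
  -- The factor `t ^ 2` cancels the `1 / t ^ 2` in the derivative of `log Z`. Differentiating the
  -- exponential restores a factor `Δ / (2 t ^ 2)`, so the proposed bound has derivative at least `B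
  -- exp ((x - Δ / t) / 2)`.
  have hule := G.energyDensity_le_of_specificHeat_le (vol := vol)
    (g := fun t => B * (2 / Δ) * (t ^ 2 * Real.exp ((x - Δ / t) / 2)))
    (g' := fun t => B * (2 / Δ) * ((2 * t + Δ / 2) * Real.exp ((x - Δ / t) / 2)))
    (fun t ht _ => by
      have h1 : HasDerivAt (fun t : ℝ => (x - Δ / t) / 2) (Δ / t ^ 2 / 2) t := by
        have := (((hasDerivAt_inv ht.ne').const_mul Δ).const_sub x).div_const 2
        simpa [div_eq_mul_inv] using this
      have h2 := ((hasDerivAt_pow 2 t).mul h1.exp).const_mul (B * (2 / Δ))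
      refine h2.congr_deriv ?_
      field_simp
      ring)
    (by
      refine squeeze_zero' (g := fun t => B * (2 / Δ) * Real.exp (x / 2) * t) ?_ ?_ (hlin _)
      · filter_upwards [self_mem_nhdsWithin] with t _
        positivity
      · filter_upwards [Ioc_mem_nhdsGT (one_pos : (0 : ℝ) < 1)] with t ht
        have h1 : t ^ 2 ≤ t := by nlinarith [ht.1, ht.2]
        have h2 : (x - Δ / t) / 2 ≤ x / 2 := by
          have : 0 < Δ / t := div_pos hΔ ht.1
          linarith
        calc B * (2 / Δ) * (t ^ 2 * Real.exp ((x - Δ / t) / 2))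
            ≤ B * (2 / Δ) * (t * Real.exp (x / 2)) := by
              have := ht.1
              gcongr
          _ = _ := by ring)
    (fun t ht h => by
      refine (hcB t ht h).trans ?_
      rw [mul_assoc]
      refine mul_le_mul_of_nonneg_left ?_ hB0.le
      rw [← mul_assoc]
      refine le_mul_of_one_le_left (Real.exp_pos _).le ?_
      have : 2 / Δ * (2 * t + Δ / 2) = 1 + 4 * t / Δ := by field_simp; ring
      rw [this]
      have : 0 < 4 * t / Δ := by positivity
      linarith)
  have hT0 : 0 < Δ / x := by positivity
  refine ⟨Δ / x, hT0, ?_⟩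
  have hlogZ := G.log_partitionFunction_le (vol := vol) (g := fun t => B * (2 / Δ) * t)
    (g' := fun _ => B * (2 / Δ)) hT0
    (fun t _ _ => by simpa using (hasDerivAt_id t).const_mul (B * (2 / Δ))) (hlin _)
    (fun t ht h => by
      rw [div_le_iff₀ (by positivity)]
      refine (hule t ht (h.trans hTle)).trans ?_
      have := hexp1 t ht h
      refine mul_le_mul_of_nonneg_left (mul_le_of_le_one_right (by positivity) this)
        (by positivity))
  have h1 : B * (2 / Δ) * (Δ / x) ≤ 2 * (uc / Δ) := by
    have e : B * (2 / Δ) * (Δ / x) = γ / x * (2 * (1 / L / Δ)) := by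
      rw [hB]; field_simp
    rw [e]
    have h2 : γ / x ≤ 1 := by rw [div_le_one hx0]; linarith
    calc γ / x * (2 * (1 / L / Δ)) ≤ 2 * (1 / L / Δ) :=
          mul_le_of_le_one_left (by positivity) h2
      _ ≤ _ := by gcongr
  have h2 : uc / (Δ / x) = x * (uc / Δ) := by field_simp
  have h3 : 2 * (a + 1 + γ / 2) * (uc / Δ) = x * (uc / Δ) + 2 * (uc / Δ) := by rw [hx]; ring
  rw [h2, h3]
  linarith

end GibbsSpectrum

/-! ### Spectral decomposition of density matrices -/

section Spectral

universe u

variable {Y : Type*}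

theorem _root_.Matrix.PosSemidef.sum_sum_nonneg {ρ : Matrix Y Y ℂ} (hρ : ρ.PosSemidef)
    (F : Finset Y) (f : Y → ℂ) : 0 ≤ ∑ x ∈ F, ∑ y ∈ F, star (f x) * ρ x y * f y := by
  have h := (hρ.submatrix ((↑) : F → Y)).dotProduct_mulVec_nonneg (fun x => f x)
  simp only [dotProduct, Matrix.mulVec, Pi.star_apply, Matrix.submatrix_apply,
    Finset.mul_sum] at h
  rw [← Finset.sum_coe_sort F]
  convert h using 2 with x
  rw [← Finset.sum_coe_sort F]
  exact Finset.sum_congr rfl fun y _ => by ring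

/-- The `2 × 2` principal minor at `x`, `y` is nonnegative. -/
theorem _root_.Matrix.PosSemidef.norm_sq_le {ρ : Matrix Y Y ℂ} (hρ : ρ.PosSemidef) (x y : Y) :
    ‖ρ x y‖ ^ 2 ≤ (ρ x x).re * (ρ y y).re := by
  have h := (hρ.submatrix ![x, y]).det_nonneg
  have hx := (Complex.nonneg_iff.1 (hρ.diag_nonneg (i := x))).2
  have hy := (Complex.nonneg_iff.1 (hρ.diag_nonneg (i := y))).2
  rw [Matrix.det_fin_two] at h
  simp only [Matrix.submatrix_apply, Matrix.cons_val_zero, Matrix.cons_val_one] at h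
  rw [← hρ.1.apply y x, Complex.star_def, Complex.mul_conj, Complex.normSq_eq_norm_sq] at h
  have := (Complex.nonneg_iff.1 h).1
  rw [Complex.sub_re, Complex.mul_re, Complex.ofReal_re, ← hx, ← hy] at this
  linarith

theorem IsDensity.diag_re_nonneg {ρ : Matrix Y Y ℂ} (hρ : IsDensity ρ) (x : Y) :
    0 ≤ (ρ x x).re :=
  (Complex.nonneg_iff.1 (hρ.posSemidef.diag_nonneg (i := x))).1

theorem IsDensity.hasSum_diag_re {ρ : Matrix Y Y ℂ} (hρ : IsDensity ρ) :
    HasSum (fun x => (ρ x x).re) 1 := by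
  simpa using Complex.hasSum_re hρ.trace_one

theorem IsDensity.summable_norm_sq {ρ : Matrix Y Y ℂ} (hρ : IsDensity ρ) (x : Y) :
    Summable fun y => ‖ρ y x‖ ^ 2 :=
  Summable.of_nonneg_of_le (fun _ => by positivity) (fun y => hρ.posSemidef.norm_sq_le y x)
    (hρ.hasSum_diag_re.summable.mul_right _)

/-- Vectors of `ℓ²(Y, ℂ)` from square-summable families. -/
def ofSummable (f : Y → ℂ) (hf : Summable fun y => ‖f y‖ ^ 2) : ℓ²(Y, ℂ) :=
  ⟨f, memℓp_gen (by simpa using hf)⟩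

theorem norm_sq_eq_tsum (f : ℓ²(Y, ℂ)) : ‖f‖ ^ 2 = ∑' y, ‖f y‖ ^ 2 := by
  simpa using lp.norm_rpow_eq_tsum (p := 2) (by simp) f

theorem hasSum_norm_sq (f : ℓ²(Y, ℂ)) : HasSum (fun y => ‖f y‖ ^ 2) (‖f‖ ^ 2) := by
  rw [norm_sq_eq_tsum]
  have := (lp.memℓp f).summable (by simp)
  exact (by simpa using this : Summable fun y => ‖f y‖ ^ 2).hasSum

namespace IsDensity

variable {ρ : Matrix Y Y ℂ} (hρ : IsDensity ρ)

/-- The column `ρ e_x` as a vector. -/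
def column (x : Y) : ℓ²(Y, ℂ) := ofSummable (fun y => ρ y x) (hρ.summable_norm_sq x)

theorem inner_column (x : Y) (f : ℓ²(Y, ℂ)) :
    HasSum (fun y => ρ x y * f y) (inner ℂ (hρ.column x) f) := by
  have h := lp.hasSum_inner (𝕜 := ℂ) (hρ.column x) f
  have e : ∀ y, ρ x y * f y = inner ℂ (hρ.column x y) (f y) := by
    intro y
    change ρ x y * f y = inner ℂ (ρ y x) (f y)
    rw [RCLike.inner_apply, mul_comm, ← hρ.posSemidef.1.apply x y]
    rfl
  simpa only [e] using h

theorem norm_column_sq_le (x : Y) : ‖hρ.column x‖ ^ 2 ≤ (ρ x x).re := by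
  rw [norm_sq_eq_tsum]
  refine (hρ.summable_norm_sq x).tsum_le_of_sum_le fun s => ?_
  calc ∑ y ∈ s, ‖ρ y x‖ ^ 2 ≤ ∑ y ∈ s, (ρ y y).re * (ρ x x).re :=
        Finset.sum_le_sum fun y _ => hρ.posSemidef.norm_sq_le y x
    _ = (∑ y ∈ s, (ρ y y).re) * (ρ x x).re := by rw [Finset.sum_mul]
    _ ≤ 1 * (ρ x x).re := by
        gcongr
        · exact hρ.diag_re_nonneg x
        · exact sum_le_hasSum s (fun y _ => hρ.diag_re_nonneg y) hρ.hasSum_diag_re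
    _ = _ := one_mul _

open Classical in
/-- The operator `|e_x⟩⟨e_x| ρ`. -/
noncomputable def rowOp (x : Y) : ℓ²(Y, ℂ) →L[ℂ] ℓ²(Y, ℂ) :=
  InnerProductSpace.rankOne ℂ (lp.single 2 x (1 : ℂ)) (hρ.column x)

open Classical in
theorem norm_sum_rowOp_le (F : Finset Y) :
    ‖∑ x ∈ F, hρ.rowOp x‖ ≤ √(∑ x ∈ F, (ρ x x).re) := by
  refine ContinuousLinearMap.opNorm_le_bound _ (Real.sqrt_nonneg _) fun f => ?_
  have h0 : 0 ≤ ∑ x ∈ F, (ρ x x).re := Finset.sum_nonneg fun x _ => hρ.diag_re_nonneg x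
  refine le_of_sq_le_sq ?_ (by positivity)
  rw [mul_pow, Real.sq_sqrt h0, Finset.sum_mul]
  have h1 : (∑ x ∈ F, hρ.rowOp x) f =
      ∑ x ∈ F, lp.single 2 x (inner ℂ (hρ.column x) f) := by
    rw [_root_.sum_apply]
    refine Finset.sum_congr rfl fun x _ => ?_
    rw [rowOp, InnerProductSpace.rankOne_apply, ← lp.single_smul, smul_eq_mul, mul_one]
  have h2 := lp.norm_sum_single (E := fun _ : Y => ℂ) (p := 2) (by simp)
    (fun x => inner ℂ (hρ.column x) f) F
  simp only [ENNReal.toReal_ofNat, Real.rpow_ofNat] at h2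
  rw [h1, h2]
  refine Finset.sum_le_sum fun x _ => ?_
  calc ‖inner ℂ (hρ.column x) f‖ ^ 2 ≤ (‖hρ.column x‖ * ‖f‖) ^ 2 := by
        gcongr; exact norm_inner_le_norm _ _
    _ = ‖hρ.column x‖ ^ 2 * ‖f‖ ^ 2 := mul_pow _ _ _
    _ ≤ _ := by gcongr; exact hρ.norm_column_sq_le x

/-- A block of rows has norm squared at most its share of the trace, so the row sums are Cauchy in
operator norm. Norm convergence is what makes the limit compact, the row operators having rank at
most one. -/
theorem summable_rowOp : Summable hρ.rowOp := by
  rw [summable_iff_vanishing_norm]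
  intro ε hε
  obtain ⟨s, hs⟩ := summable_iff_vanishing_norm.1 hρ.hasSum_diag_re.summable (ε ^ 2) (by positivity)
  refine ⟨s, fun t ht => (hρ.norm_sum_rowOp_le t).trans_lt ?_⟩
  rw [Real.sqrt_lt' hε]
  exact (le_abs_self _).trans_lt (hs t ht)

/-- The operator with matrix `ρ`. -/
noncomputable def toOp : ℓ²(Y, ℂ) →L[ℂ] ℓ²(Y, ℂ) := ∑' x, hρ.rowOp x

theorem isCompactOperator_toOp : IsCompactOperator hρ.toOp := by
  classical
  refine isCompactOperator_of_tendsto hρ.summable_rowOp.hasSum (Eventually.of_forall fun F => ?_)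
  have : ∑ x ∈ F, hρ.rowOp x ∈ compactOperator (RingHom.id ℂ) ℓ²(Y, ℂ) ℓ²(Y, ℂ) := by
    refine Submodule.sum_mem _ fun x _ => ?_
    change IsCompactOperator (hρ.rowOp x)
    rw [rowOp, InnerProductSpace.rankOne_def']
    have h : IsCompactOperator (ContinuousLinearMap.toSpanSingleton ℂ
        (lp.single (E := fun _ : Y => ℂ) 2 x (1 : ℂ))) :=
      isCompactOperator_of_locallyCompactSpace_rng _
    exact h.comp_clm _
  exact this

theorem toOp_apply (f : ℓ²(Y, ℂ)) (x : Y) : hρ.toOp f x = inner ℂ (hρ.column x) f := by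
  classical
  have h1 : HasSum (fun z => hρ.rowOp z f) (hρ.toOp f) :=
    hρ.summable_rowOp.hasSum.mapL (ContinuousLinearMap.apply ℂ _ f)
  have h2 : HasSum (fun z => inner ℂ (lp.single 2 x (1 : ℂ)) (hρ.rowOp z f))
      (inner ℂ (lp.single 2 x (1 : ℂ)) (hρ.toOp f)) := h1.mapL (innerSL ℂ _)
  have h3 : inner ℂ (lp.single 2 x (1 : ℂ)) (hρ.toOp f) = hρ.toOp f x := by
    rw [lp.inner_single_left]; simp
  rw [h3] at h2
  refine h2.unique ?_
  have h4 : ∀ z, inner ℂ (lp.single 2 x (1 : ℂ)) (hρ.rowOp z f) =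
      if z = x then inner ℂ (hρ.column x) f else 0 := by
    intro z
    rw [rowOp, InnerProductSpace.rankOne_apply, inner_smul_right, lp.inner_single_left,
      lp.single_apply, Pi.single_apply]
    by_cases h : x = z
    · subst h; simp
    · simp [h, Ne.symm h]
  simp only [h4]
  exact hasSum_ite_eq x _

open Classical in
theorem toOp_single (x y : Y) : hρ.toOp (lp.single 2 y (1 : ℂ)) x = ρ x y := by
  rw [toOp_apply, lp.inner_single_right]
  change inner ℂ (ρ y x) 1 = ρ x y
  rw [RCLike.inner_apply, one_mul, ← hρ.posSemidef.1.apply x y]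
  rfl

theorem isSymmetric_toOp : hρ.toOp.IsSymmetric := by
  classical
  rw [← ContinuousLinearMap.isSelfAdjoint_iff_isSymmetric,
    ContinuousLinearMap.isSelfAdjoint_iff']
  refine lp.ext_continuousLinearMap (p := 2) (by simp) fun y => ?_
  ext x
  have h := ContinuousLinearMap.adjoint_inner_right hρ.toOp (lp.single 2 x (1 : ℂ))
    (lp.single 2 y (1 : ℂ))
  rw [lp.inner_single_left, lp.inner_single_right, hρ.toOp_single] at h
  simp only [RCLike.inner_apply, map_one, one_mul, mul_one] at h
  simp only [ContinuousLinearMap.comp_apply, lp.singleContinuousLinearMap_apply]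
  rw [h, hρ.toOp_single, ← hρ.posSemidef.1.apply x y]
  rfl

theorem re_inner_toOp_nonneg (f : ℓ²(Y, ℂ)) : 0 ≤ (inner ℂ f (hρ.toOp f)).re := by
  classical
  have h1 := lp.hasSum_single (E := fun _ : Y => ℂ) (p := 2) (by simp) f
  have hc : Continuous fun g : ℓ²(Y, ℂ) => (inner ℂ g (hρ.toOp g)).re := by fun_prop
  refine ge_of_tendsto (hc.continuousAt.tendsto.comp h1) (Eventually.of_forall fun F => ?_)
  have h2 := (Complex.nonneg_iff.1 (hρ.posSemidef.sum_sum_nonneg F f)).1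
  refine h2.trans_eq (congrArg Complex.re ?_)
  rw [sum_inner]
  refine Finset.sum_congr rfl fun x _ => ?_
  rw [map_sum, inner_sum]
  refine Finset.sum_congr rfl fun y _ => ?_
  have : lp.single 2 y (f y) = f y • lp.single (E := fun _ : Y => ℂ) 2 y (1 : ℂ) := by
    rw [← lp.single_smul, smul_eq_mul, mul_one]
  rw [this, map_smul, inner_smul_right, lp.inner_single_left, hρ.toOp_single, RCLike.inner_apply]
  simp only [Complex.star_def]
  ring

theorem mem_eigenspace_iff (μ : ℝ) (v : ℓ²(Y, ℂ)) :
    v ∈ eigenspace ρ μ ↔ v ∈ Module.End.eigenspace (hρ.toOp : Module.End ℂ ℓ²(Y, ℂ)) (μ : ℂ) := by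
  rw [Module.End.mem_eigenspace_iff]
  constructor
  · intro h
    ext x
    exact (hρ.toOp_apply v x).trans ((hρ.inner_column x v).unique (h x))
  · intro h x
    have h1 := hρ.inner_column x v
    rw [← hρ.toOp_apply] at h1
    have h2 : hρ.toOp v = (μ : ℂ) • v := h
    rw [h2] at h1
    exact h1

end IsDensity

/-- `ρ = ∑ k, p k |v k⟩⟨v k|` with orthonormal `v` and probabilities `p`. -/
structure IsSpectralDecomposition {K : Type*} (ρ : Matrix Y Y ℂ) (p : K → ℝ)
    (v : K → ℓ²(Y, ℂ)) : Prop where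
  orthonormal : Orthonormal ℂ v
  nonneg : ∀ k, 0 ≤ p k
  tsum_eq_one : ∑' k, ENNReal.ofReal (p k) = 1
  hasSum : ∀ x y, HasSum (fun k => (p k : ℂ) * v k x * star (v k y)) (ρ x y)

theorem tsum_ofReal_norm_sq (f : ℓ²(Y, ℂ)) :
    ∑' x, ENNReal.ofReal (‖f x‖ ^ 2) = ENNReal.ofReal (‖f‖ ^ 2) := by
  rw [← ENNReal.ofReal_tsum_of_nonneg (fun _ => by positivity) (hasSum_norm_sq f).summable,
    (hasSum_norm_sq f).tsum_eq]

/-- For `ρ = ∑ k, p k |v k⟩⟨v k|` with unit vectors `v k`, the weights sum to the trace. -/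
theorem IsDensity.tsum_weights_eq_one {K : Type*} {ρ : Matrix Y Y ℂ} (hρ : IsDensity ρ)
    {p : K → ℝ} {v : K → ℓ²(Y, ℂ)} (hv : ∀ k, ‖v k‖ = 1) (hp : ∀ k, 0 ≤ p k)
    (h : ∀ x y, HasSum (fun k => (p k : ℂ) * v k x * star (v k y)) (ρ x y)) :
    ∑' k, ENNReal.ofReal (p k) = 1 := by
  have h1 : ∀ x, HasSum (fun k => p k * ‖v k x‖ ^ 2) (ρ x x).re := by
    intro x
    convert Complex.hasSum_re (h x x) using 2 with k
    rw [mul_assoc, Complex.star_def, Complex.mul_conj, Complex.normSq_eq_norm_sq,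
      ← Complex.ofReal_mul, Complex.ofReal_re]
  have hpn : ∀ k x, 0 ≤ p k * ‖v k x‖ ^ 2 := fun k x => mul_nonneg (hp k) (by positivity)
  have h2 : ∑' x, ∑' k, ENNReal.ofReal (p k * ‖v k x‖ ^ 2) = 1 := by
    have : ∀ x, ∑' k, ENNReal.ofReal (p k * ‖v k x‖ ^ 2) = ENNReal.ofReal (ρ x x).re := by
      intro x
      rw [← ENNReal.ofReal_tsum_of_nonneg (fun k => hpn k x) (h1 x).summable, (h1 x).tsum_eq]
    simp only [this]
    rw [← ENNReal.ofReal_tsum_of_nonneg hρ.diag_re_nonneg hρ.hasSum_diag_re.summable,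
      hρ.hasSum_diag_re.tsum_eq, ENNReal.ofReal_one]
  rw [ENNReal.tsum_comm] at h2
  rw [← h2]
  refine tsum_congr fun k => ?_
  simp only [ENNReal.ofReal_mul (hp k)]
  rw [ENNReal.tsum_mul_left, tsum_ofReal_norm_sq, hv k]
  simp

/-- Only an inequality holds: `finrank` is `0` in infinite dimension. It goes in the direction
needed to bound the entropy from above. -/
theorem finrank_le_card_hilbertBasis {E : Type*} [NormedAddCommGroup E] [InnerProductSpace ℂ E]
    {κ : Type*} (b : HilbertBasis κ ℂ E) : (Module.finrank ℂ E : ℝ≥0∞) ≤ ENat.card κ := by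
  cases finite_or_infinite κ
  · have := Fintype.ofFinite κ
    rw [Module.finrank_eq_card_basis b.toOrthonormalBasis.toBasis]
    simp
  · simp

/-- Hilbert bases of the eigenspaces of a compact self-adjoint operator form a Hilbert basis. -/
theorem exists_hilbertBasis_eigenvectors {E : Type u} [NormedAddCommGroup E]
    [InnerProductSpace ℂ E] [CompleteSpace E] (T : E →L[ℂ] E) (hT : IsCompactOperator T)
    (hT' : T.IsSymmetric) :
    ∃ (w : ℂ → Type u) (B : HilbertBasis (Σ μ : ℂ, w μ) ℂ E), (∀ k, T (B k) = k.1 • B k) ∧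
      ∀ μ : ℂ, (Module.finrank ℂ (Module.End.eigenspace (T : Module.End ℂ E) μ) : ℝ≥0∞) ≤
        ENat.card (w μ) := by
  have hcl : ∀ μ : ℂ, CompleteSpace (Module.End.eigenspace (T : Module.End ℂ E) μ) := by
    intro μ
    have : IsClosed (Module.End.eigenspace (T : Module.End ℂ E) μ : Set E) := by
      have h : (Module.End.eigenspace (T : Module.End ℂ E) μ : Set E) = {v | T v = μ • v} := by
        ext v; exact Module.End.mem_eigenspace_iff
      rw [h]
      exact isClosed_eq (by fun_prop) (by fun_prop)
    exact this.completeSpace_coe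
  choose w b _ using fun μ : ℂ =>
    exists_hilbertBasis ℂ (Module.End.eigenspace (T : Module.End ℂ E) μ)
  let v : (Σ μ : ℂ, w μ) → E := fun k => (b k.1 k.2 : E)
  have hort : Orthonormal ℂ v :=
    (hT'.orthogonalFamily_eigenspaces).orthonormal_sigma_orthonormal
      (fun μ => (b μ).orthonormal)
  -- By the spectral theorem the eigenspaces have trivial common orthogonal complement; a vector
  -- orthogonal to a Hilbert basis of each is orthogonal to each of them.
  have hbot : (Submodule.span ℂ (Set.range v))ᗮ = ⊥ := by
    rw [eq_bot_iff, ← ContinuousLinearMap.orthogonalComplement_iSup_eigenspaces_eq_bot hT hT']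
    intro z hz
    rw [← Submodule.iInf_orthogonal, Submodule.mem_iInf]
    intro μ
    rw [Submodule.mem_orthogonal] at hz ⊢
    intro u hu
    have h1 := ((b μ).hasSum_repr ⟨u, hu⟩).mapL
      (Submodule.subtypeL (Module.End.eigenspace (T : Module.End ℂ E) μ))
    have h2 := h1.mapL (innerSL ℂ z)
    have h3 : ∀ k, innerSL ℂ z (Submodule.subtypeL (Module.End.eigenspace (T : Module.End ℂ E) μ)
        ((b μ).repr ⟨u, hu⟩ k • b μ k)) = 0 := by
      intro k
      rw [map_smul, map_smul, innerSL_apply_apply]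
      have : inner ℂ z (b μ k : E) = 0 :=
        inner_eq_zero_symm.1 (hz (v ⟨μ, k⟩) (Submodule.subset_span ⟨_, rfl⟩))
      rw [Submodule.subtypeL_apply, this, smul_zero]
    simp only [h3] at h2
    exact inner_eq_zero_symm.1 (h2.unique hasSum_zero)
  refine ⟨fun μ => w μ, HilbertBasis.mkOfOrthogonalEqBot hort hbot, fun k => ?_,
    fun μ => finrank_le_card_hilbertBasis (b μ)⟩
  rw [HilbertBasis.coe_mkOfOrthogonalEqBot]
  exact Module.End.mem_eigenspace_iff.1 (b k.1 k.2).2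

theorem IsDensity.exists_spectralDecomposition {Y : Type u} {ρ : Matrix Y Y ℂ}
    (hρ : IsDensity ρ) :
    ∃ (K : Type u) (p : K → ℝ) (v : K → ℓ²(Y, ℂ)), IsSpectralDecomposition ρ p v ∧
      entropy ρ ≤ ∑' k, ENNReal.ofReal (Real.negMulLog (p k)) := by
  classical
  obtain ⟨w, B, hTv, hw⟩ := exists_hilbertBasis_eigenvectors hρ.toOp
    hρ.isCompactOperator_toOp hρ.isSymmetric_toOp
  -- Writing an eigenvalue as a quadratic form in its unit eigenvector gives both its reality and
  -- its nonnegativity.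
  have heig : ∀ k : (Σ μ : ℂ, w μ), k.1 = inner ℂ (B k) (hρ.toOp (B k)) := by
    intro k
    rw [hTv, inner_smul_right, inner_self_eq_norm_sq_to_K, B.orthonormal.1 k]
    simp
  have hreal : ∀ k : (Σ μ : ℂ, w μ), ((k.1.re : ℝ) : ℂ) = k.1 := by
    intro k
    rw [← Complex.conj_eq_iff_re]
    nth_rw 1 [heig k]
    rw [inner_conj_symm]
    exact (hρ.isSymmetric_toOp (B k) (B k)).trans (heig k).symm
  have hnn : ∀ k : (Σ μ : ℂ, w μ), 0 ≤ k.1.re := by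
    intro k
    rw [heig k]
    exact hρ.re_inner_toOp_nonneg (B k)
  have hsum : ∀ x y, HasSum (fun k : (Σ μ : ℂ, w μ) => (k.1.re : ℂ) * B k x * star (B k y))
      (ρ x y) := by
    intro x y
    have h := B.hasSum_inner_mul_inner (lp.single 2 x (1 : ℂ))
      (hρ.toOp (lp.single 2 y (1 : ℂ)))
    rw [lp.inner_single_left, hρ.toOp_single] at h
    simp only [RCLike.inner_apply, map_one, mul_one] at h
    have e : ∀ k, inner ℂ (lp.single 2 x (1 : ℂ)) (B k) *
        inner ℂ (B k) (hρ.toOp (lp.single 2 y (1 : ℂ))) =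
        (k.1.re : ℂ) * B k x * star (B k y) := by
      intro k
      have h2 : inner ℂ (B k) (hρ.toOp (lp.single 2 y (1 : ℂ))) =
          inner ℂ (hρ.toOp (B k)) (lp.single 2 y (1 : ℂ)) :=
        (hρ.isSymmetric_toOp (B k) (lp.single 2 y (1 : ℂ))).symm
      rw [h2, hTv, inner_smul_left, ← hreal k, Complex.conj_ofReal, lp.inner_single_left,
        lp.inner_single_right]
      simp only [RCLike.inner_apply, map_one, mul_one, one_mul, Complex.ofReal_re,
        Complex.star_def]
      ring
    simpa only [e] using h
  have h1 : IsSpectralDecomposition ρ (fun k : (Σ μ : ℂ, w μ) => k.1.re) B :=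
    ⟨B.orthonormal, hnn, hρ.tsum_weights_eq_one B.orthonormal.1 hnn hsum, hsum⟩
  refine ⟨(Σ μ : ℂ, w μ), fun k => k.1.re, B, h1, ?_⟩
  rw [ENNReal.tsum_sigma (fun (μ : ℂ) (_ : w μ) => ENNReal.ofReal (Real.negMulLog μ.re)), entropy]
  calc ∑' μ : ℝ, (Module.finrank ℂ (eigenspace ρ μ) : ℝ≥0∞) *
        ENNReal.ofReal (Real.negMulLog μ)
      ≤ ∑' μ : ℝ, ∑' _ : w (μ : ℂ), ENNReal.ofReal (Real.negMulLog (μ : ℂ).re) := by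
        refine ENNReal.tsum_le_tsum fun μ => ?_
        rw [ENNReal.tsum_const, Complex.ofReal_re]
        have : eigenspace ρ μ =
            Module.End.eigenspace (hρ.toOp : Module.End ℂ ℓ²(Y, ℂ)) (μ : ℂ) := by
          ext u; exact hρ.mem_eigenspace_iff μ u
        rw [this]
        exact mul_le_mul_left (hw (μ : ℂ)) _
    _ ≤ _ := ENNReal.tsum_comp_le_tsum_of_injective Complex.ofReal_injective
        (fun μ : ℂ => ∑' _ : w μ, ENNReal.ofReal (Real.negMulLog μ.re))

end Spectral

/-! ### The Gibbs variational principle -/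

section Variational

variable {Y ι K : Type*} {A ρ : Matrix Y Y ℂ} {p : K → ℝ} {v : K → ℓ²(Y, ℂ)}

theorem HasTrace.tendsto (h : HasTrace A ρ) :
    Tendsto (truncTrace A ρ) atTop (𝓝 (expect A ρ)) := by
  obtain ⟨t, ht⟩ := h
  exact tendsto_nhds_limUnder ⟨t, ht⟩

theorem expect_eq {t : ℂ} (h : Tendsto (truncTrace A ρ) atTop (𝓝 t)) : expect A ρ = t :=
  h.limUnder_eq

theorem ENNReal_tsum_tsum_le {α β : Type*} {f : α → β → ℝ≥0∞} {c : ℝ≥0∞}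
    (h : ∀ (s : Finset α) (t : Finset β), ∑ a ∈ s, ∑ b ∈ t, f a b ≤ c) :
    ∑' a, ∑' b, f a b ≤ c := by
  classical
  rw [← ENNReal.tsum_prod, ENNReal.tsum_eq_iSup_sum]
  refine iSup_le fun s => ?_
  calc ∑ q ∈ s, f q.1 q.2 ≤ ∑ q ∈ s.image Prod.fst ×ˢ s.image Prod.snd, f q.1 q.2 :=
        Finset.sum_le_sum_of_subset Finset.subset_product
    _ ≤ c := by
        rw [Finset.sum_product]
        exact h _ _

/-- This is `log y ≤ y - 1` at `y = exp (-E / T) / (Z q)`, multiplied by `q`. The summand `q` stays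
on the left so that all terms are nonnegative when `0 ≤ q ≤ 1`, `0 ≤ E`, `0 < T` and `1 ≤ Z`. -/
theorem negMulLog_add_le {q E T Z : ℝ} (hq : 0 ≤ q) (hZ : 0 < Z) :
    Real.negMulLog q + q ≤ q * (E / T) + q * Real.log Z + Real.exp (-E / T) / Z := by
  rcases hq.eq_or_lt with rfl | hq
  · simp; positivity
  · have h := Real.log_le_sub_one_of_pos (show 0 < Real.exp (-E / T) / Z / q by positivity)
    rw [Real.log_div (by positivity) hq.ne', Real.log_div (by positivity) hZ.ne',
      Real.log_exp] at h
    have h2 := mul_le_mul_of_nonneg_left h hq.le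
    have e : q * (Real.exp (-E / T) / Z / q - 1) = Real.exp (-E / T) / Z - q := by
      field_simp
    rw [e] at h2
    rw [Real.negMulLog]
    have e2 : -E / T = -(E / T) := neg_div _ _
    rw [e2] at h2 ⊢
    linarith

namespace IsSpectralDecomposition

variable (hs : IsSpectralDecomposition ρ p v)

include hs

theorem le_one (k : K) : p k ≤ 1 := by
  have := (ENNReal.le_tsum (f := fun k => ENNReal.ofReal (p k)) k).trans_eq hs.tsum_eq_one
  simpa using this

theorem tsum_ofReal_norm_inner_sq_right (B : HilbertBasis ι ℂ ℓ²(Y, ℂ)) (k : K) :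
    ∑' α, ENNReal.ofReal (‖inner ℂ (B α) (v k)‖ ^ 2) = 1 := by
  have h := Complex.hasSum_re (B.hasSum_inner_mul_inner (v k) (v k))
  have e : ∀ α, (inner ℂ (v k) (B α) * inner ℂ (B α) (v k)).re =
      ‖inner ℂ (B α) (v k)‖ ^ 2 := by
    intro α
    rw [← inner_conj_symm (v k) (B α), mul_comm, Complex.mul_conj, Complex.normSq_eq_norm_sq,
      Complex.ofReal_re]
  simp only [e] at h
  rw [← ENNReal.ofReal_tsum_of_nonneg (fun _ => by positivity) h.summable, h.tsum_eq,
    inner_self_eq_norm_sq_to_K, hs.orthonormal.1 k]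
  simp

/-- Bessel's inequality: the family `v` need not be complete, unlike the energy eigenbasis. -/
theorem tsum_ofReal_norm_inner_sq_left (B : HilbertBasis ι ℂ ℓ²(Y, ℂ)) (α : ι) :
    ∑' k, ENNReal.ofReal (‖inner ℂ (B α) (v k)‖ ^ 2) ≤ 1 := by
  have h := hs.orthonormal.tsum_inner_products_le (x := B α)
  rw [B.orthonormal.1 α, one_pow] at h
  simp only [fun k => norm_inner_symm (𝕜 := ℂ) (B α) (v k)]
  rw [← ENNReal.ofReal_tsum_of_nonneg (fun _ => by positivity)
    (hs.orthonormal.inner_products_summable (B α))]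
  simpa using h

/-- With `P_N` the projection onto `N`, the truncated trace is `∑ α, E α ⟨P_N b α, ρ P_N b α⟩`, and
expanding `ρ` gives a double series of nonnegative terms. Finite partial sums lie below it. -/
theorem sum_energy_trunc_le (G : GibbsSpectrum A ι) (S : Finset ι) (F : Finset K)
    (N : Finset Y) :
    ∑ α ∈ S, ∑ k ∈ F, G.energy α * p k * ‖∑ x ∈ N, star (G.basis α x) * v k x‖ ^ 2 ≤
      (truncTrace A ρ N).re := by
  set Q : ι → ℂ := fun α => ∑ x ∈ N, ∑ y ∈ N, G.basis α x * star (G.basis α y) * ρ y x with hQ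
  have h1 : HasSum (fun α => G.energy α * Q α) (truncTrace A ρ N) := by
    have := hasSum_sum fun x (_ : x ∈ N) => hasSum_sum fun y (_ : y ∈ N) =>
      (G.matrix_eq x y).mul_right (ρ y x)
    have e : ∀ α, ∑ x ∈ N, ∑ y ∈ N, (G.energy α : ℂ) * G.basis α x * star (G.basis α y) * ρ y x =
        G.energy α * Q α := by
      intro α
      simp only [hQ, Finset.mul_sum, mul_assoc]
    simp only [e] at this
    exact this
  have h2 : ∀ α, HasSum (fun k => p k * ‖∑ x ∈ N, star (G.basis α x) * v k x‖ ^ 2) (Q α).re := by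
    intro α
    have := hasSum_sum fun x (_ : x ∈ N) => hasSum_sum fun y (_ : y ∈ N) =>
      (hs.hasSum y x).mul_left (G.basis α x * star (G.basis α y))
    convert Complex.hasSum_re this using 2 with k
    rw [← Complex.ofReal_re (p k * _), Complex.ofReal_mul, ← Complex.normSq_eq_norm_sq,
      ← Complex.mul_conj, map_sum, Finset.sum_mul_sum, Finset.mul_sum, Finset.sum_comm]
    congr 1
    refine Finset.sum_congr rfl fun x _ => ?_
    rw [Finset.mul_sum]
    refine Finset.sum_congr rfl fun y _ => ?_
    simp only [map_mul, Complex.star_def, Complex.conj_conj]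
    ring
  have hp : ∀ α k, 0 ≤ p k * ‖∑ x ∈ N, star (G.basis α x) * v k x‖ ^ 2 :=
    fun α k => mul_nonneg (hs.nonneg k) (by positivity)
  have h3 : HasSum (fun α => G.energy α * (Q α).re) (truncTrace A ρ N).re := by
    simpa using Complex.hasSum_re h1
  refine le_trans ?_ (sum_le_hasSum S (fun α _ => mul_nonneg (G.energy_nonneg α)
    ((h2 α).nonneg (hp α))) h3)
  refine Finset.sum_le_sum fun α _ => ?_
  simp only [mul_assoc]
  rw [← Finset.mul_sum]
  exact mul_le_mul_of_nonneg_left (sum_le_hasSum F (fun k _ => hp α k) (h2 α))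
    (G.energy_nonneg α)

/-- A Fatou argument: with `S` and `F` finite, `N` can be sent to infinity term by term. Equality of
the two energies is never needed. -/
theorem sum_energy_le (G : GibbsSpectrum A ι) (htr : HasTrace A ρ) (S : Finset ι)
    (F : Finset K) :
    ∑ α ∈ S, ∑ k ∈ F, G.energy α * p k * ‖inner ℂ (G.basis α) (v k)‖ ^ 2 ≤
      (expect A ρ).re := by
  refine le_of_tendsto_of_tendsto' ?_ ((Complex.continuous_re.tendsto _).comp htr.tendsto)
    (fun N => hs.sum_energy_trunc_le G S F N)
  refine tendsto_finsetSum _ fun α _ => tendsto_finsetSum _ fun k _ => ?_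
  refine Tendsto.const_mul _ (Tendsto.pow (Tendsto.norm ?_) 2)
  have h := lp.hasSum_inner (𝕜 := ℂ) (G.basis α) (v k)
  have e : ∀ x, inner ℂ (G.basis α x) (v k x) = star (G.basis α x) * v k x := by
    intro x
    rw [RCLike.inner_apply, mul_comm]; rfl
  simp only [e] at h
  exact h

theorem tsum_negMulLog_le (G : GibbsSpectrum A ι) (htr : HasTrace A ρ) {T : ℝ} (hT : 0 < T) :
    ∑' k, ENNReal.ofReal (Real.negMulLog (p k)) ≤
      ENNReal.ofReal ((expect A ρ).re / T + Real.log (G.partitionFunction T)) := by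
  have hZ := G.partitionFunction_pos hT
  have hlogZ : 0 ≤ Real.log (G.partitionFunction T) :=
    Real.log_nonneg (G.one_le_partitionFunction hT)
  set Z := G.partitionFunction T with hZdef
  have hE0 : 0 ≤ (expect A ρ).re := by simpa using hs.sum_energy_le G htr ∅ ∅
  set D : ι → K → ℝ := fun α k => ‖inner ℂ (G.basis α) (v k)‖ ^ 2 with hD
  have hD0 : ∀ α k, 0 ≤ D α k := fun α k => by positivity
  have hEn := G.energy_nonneg
  have hpn := hs.nonneg
  have hnm : ∀ k, 0 ≤ Real.negMulLog (p k) := fun k =>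
    Real.negMulLog_nonneg (hpn k) (hs.le_one k)
  set w : ι → ℝ := fun α => Real.exp (-G.energy α / T) / Z with hw
  have hw0 : ∀ α, 0 ≤ w α := fun α => by positivity
  have hwsum : ∑' α, ENNReal.ofReal (w α) = 1 := by
    rw [← ENNReal.ofReal_tsum_of_nonneg hw0 ((G.summable_exp T hT).div_const Z), tsum_div_const,
      ← GibbsSpectrum.partitionFunction, ← hZdef, div_self hZ.ne', ENNReal.ofReal_one]
  have hright : ∀ c : K → ℝ≥0∞, ∑' α, ∑' k, ENNReal.ofReal (D α k) * c k = ∑' k, c k := by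
    intro c
    rw [ENNReal.tsum_comm]
    refine tsum_congr fun k => ?_
    rw [ENNReal.tsum_mul_right, hs.tsum_ofReal_norm_inner_sq_right G.basis k, one_mul]
  -- The scalar inequality is weighted by the overlaps `D α k`. Summed over both indices, the extra
  -- `p k` gives `1` on the left and the weights `w α` at most `1` on the right; these cancel at the
  -- end.
  have hpt : ∀ α k,
      ENNReal.ofReal (D α k) * (ENNReal.ofReal (Real.negMulLog (p k)) + ENNReal.ofReal (p k)) ≤
      ENNReal.ofReal (G.energy α * p k * D α k) * ENNReal.ofReal (1 / T) +
        ENNReal.ofReal (D α k) * (ENNReal.ofReal (p k) * ENNReal.ofReal (Real.log Z)) +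
        ENNReal.ofReal (D α k) * ENNReal.ofReal (w α) := by
    intro α k
    have hk := hpn k
    have hα := hEn α
    have hDk := hD0 α k
    have hwα := hw0 α
    rw [← ENNReal.ofReal_add (hnm k) hk, ← ENNReal.ofReal_mul hDk,
      ← ENNReal.ofReal_mul (by positivity), ← ENNReal.ofReal_mul hk, ← ENNReal.ofReal_mul hDk,
      ← ENNReal.ofReal_mul hDk, ← ENNReal.ofReal_add (by positivity) (by positivity),
      ← ENNReal.ofReal_add (by positivity) (by positivity)]
    refine ENNReal.ofReal_le_ofReal ?_
    have := mul_le_mul_of_nonneg_left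
      (negMulLog_add_le (E := G.energy α) (T := T) hk hZ) hDk
    refine this.trans_eq ?_
    simp only [hw]
    ring
  have hsum := ENNReal.tsum_le_tsum fun α => ENNReal.tsum_le_tsum fun k => hpt α k
  simp only [ENNReal.tsum_add] at hsum
  simp only [hright, mul_add, ENNReal.tsum_add, ENNReal.tsum_mul_right, hs.tsum_eq_one,
    one_mul] at hsum
  have h1 : ∑' α, ∑' k, ENNReal.ofReal (G.energy α * p k * D α k) ≤
      ENNReal.ofReal (expect A ρ).re := by
    refine ENNReal_tsum_tsum_le fun S F => ?_
    rw [← Finset.sum_congr rfl fun α _ => ENNReal.ofReal_sum_of_nonneg fun k _ =>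
        mul_nonneg (mul_nonneg (hEn α) (hpn k)) (hD0 α k),
      ← ENNReal.ofReal_sum_of_nonneg fun α _ => Finset.sum_nonneg fun k _ =>
        mul_nonneg (mul_nonneg (hEn α) (hpn k)) (hD0 α k)]
    exact ENNReal.ofReal_le_ofReal (hs.sum_energy_le G htr S F)
  have h2 : ∑' α, (∑' k, ENNReal.ofReal (D α k)) * ENNReal.ofReal (w α) ≤ 1 := by
    rw [← hwsum]
    refine ENNReal.tsum_le_tsum fun α => ?_
    exact mul_le_of_le_one_left' (hs.tsum_ofReal_norm_inner_sq_left G.basis α)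
  have h3 : ∑' k, ENNReal.ofReal (Real.negMulLog (p k)) + 1 ≤
      ENNReal.ofReal ((expect A ρ).re / T + Real.log Z) + 1 := by
    refine hsum.trans ?_
    rw [ENNReal.ofReal_add (by positivity) hlogZ, div_eq_mul_one_div (expect A ρ).re, ENNReal.ofReal_mul hE0]
    gcongr
  exact (ENNReal.add_le_add_iff_right ENNReal.one_ne_top).1 h3

end IsSpectralDecomposition

end Variational

/-! ### Sums over product types -/

section ProductSums

universe u w

theorem ENNReal_tsum_pi_prod {M : Type u} [Fintype M] (α : M → Type w)
    (f : ∀ m, α m → ℝ≥0∞) :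
    ∑' x : ∀ m, α m, ∏ m, f m (x m) = ∏ m, ∑' a, f m a := by
  refine Fintype.induction_empty_option (P := fun M _ => ∀ (α : M → Type w)
    (f : ∀ m, α m → ℝ≥0∞), ∑' x : ∀ m, α m, ∏ m, f m (x m) = ∏ m, ∑' a, f m a) ?_ ?_ ?_ M α f
  · intro M M' _ e ih α f
    let _ := Fintype.ofEquiv M' e.symm
    rw [← (Equiv.piCongrLeft α e).tsum_eq, ← e.prod_comp, ← ih]
    refine tsum_congr fun x => ?_
    rw [← e.prod_comp]
    simp only [Equiv.piCongrLeft_apply_apply]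
  · simp
  · intro M _ ih α f
    rw [← (Equiv.piOptionEquivProd (β := α)).symm.tsum_eq, ENNReal.tsum_prod
      (f := fun a y => ∏ m, f m (Equiv.piOptionEquivProd.symm (a, y) m)),
      Fintype.prod_option, ← ih, ← ENNReal.tsum_mul_right]
    refine tsum_congr fun a => ?_
    rw [← ENNReal.tsum_mul_left]
    refine tsum_congr fun x => ?_
    rw [Fintype.prod_option]
    rfl

theorem hasSum_mul_prod {𝕜 α β : Type*} [RCLike 𝕜] {f : α → 𝕜} {g : β → 𝕜} {s t : 𝕜}
    (hf : HasSum f s) (hg : HasSum g t) :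
    HasSum (fun q : α × β => f q.1 * g q.2) (s * t) := by
  have h : Summable (fun q : α × β => f q.1 * g q.2) :=
    summable_mul_of_summable_norm hf.summable.norm hg.summable.norm
  exact hf.mul hg h

/-- Products of convergent sums over the factors of a finite product type converge. -/
def HasSumPiProd (𝕜 : Type*) [RCLike 𝕜] (M : Type u) [Fintype M] : Prop :=
  ∀ (α : M → Type w) (f : ∀ m, α m → 𝕜) (s : M → 𝕜), (∀ m, HasSum (f m) (s m)) →
    HasSum (fun x : ∀ m, α m => ∏ m, f m (x m)) (∏ m, s m)

theorem hasSumPiProd (𝕜 : Type*) [RCLike 𝕜] (M : Type u) [Fintype M] :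
    HasSumPiProd.{u, w} 𝕜 M := by
  refine Fintype.induction_empty_option (P := fun M _ => HasSumPiProd 𝕜 M) ?_ ?_ ?_ M
  · intro M M' _ e ih α f s hf
    let _ := Fintype.ofEquiv M' e.symm
    rw [← (Equiv.piCongrLeft α e).hasSum_iff, ← e.prod_comp]
    have := ih (fun m => α (e m)) (fun m => f (e m)) (fun m => s (e m)) (fun m => hf (e m))
    refine this.congr_fun fun x => ?_
    rw [Function.comp_apply, ← e.prod_comp]
    simp only [Equiv.piCongrLeft_apply_apply]
  · intro α f s hf
    simp only [Finset.univ_eq_empty, Finset.prod_empty]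
    exact hasSum_unique (fun x : ∀ m : PEmpty, α m => (1 : 𝕜))
  · intro M _ ih α f s hf
    rw [← (Equiv.piOptionEquivProd (β := α)).symm.hasSum_iff, Fintype.prod_option]
    have h1 := ih (fun m => α (some m)) (fun m => f (some m)) (fun m => s (some m))
      (fun m => hf (some m))
    have h2 := hasSum_mul_prod (hf none) h1
    refine h2.congr_fun fun x => ?_
    rw [Function.comp_apply, Fintype.prod_option]
    rfl

theorem hasSum_pi_prod {𝕜 : Type*} [RCLike 𝕜] {M : Type u} [Fintype M] {α : M → Type w}
    {f : ∀ m, α m → 𝕜} {s : M → 𝕜} (hf : ∀ m, HasSum (f m) (s m)) :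
    HasSum (fun x : ∀ m, α m => ∏ m, f m (x m)) (∏ m, s m) :=
  hasSumPiProd 𝕜 M α f s hf

/-- `negMulLog` obeys the Leibniz rule of a derivation. Additivity of entropy follows on summing, as
every undifferentiated factor sums to `1`. -/
theorem negMulLog_prod {M : Type*} [DecidableEq M] (s : Finset M) (x : M → ℝ) :
    Real.negMulLog (∏ m ∈ s, x m) =
      ∑ m ∈ s, ∏ m' ∈ s, (if m' = m then Real.negMulLog (x m') else x m') := by
  induction s using Finset.induction_on with
  | empty => simp
  | insert a s ha ih =>
    rw [Finset.prod_insert ha, Real.negMulLog_mul, ih, Finset.sum_insert ha,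
      Finset.prod_insert ha, if_pos rfl, Finset.mul_sum]
    congr 1
    · rw [mul_comm]
      congr 1
      refine Finset.prod_congr rfl fun m hm => ?_
      rw [if_neg (ne_of_mem_of_not_mem hm ha)]
    · refine Finset.sum_congr rfl fun m hm => ?_
      rw [Finset.prod_insert ha, if_neg (ne_of_mem_of_not_mem hm ha).symm]

theorem tsum_negMulLog_pi_prod {M : Type u} [Fintype M] (K : M → Type w)
    (p : ∀ m, K m → ℝ) (hp0 : ∀ m k, 0 ≤ p m k) (hp1 : ∀ m k, p m k ≤ 1)
    (hp : ∀ m, ∑' k, ENNReal.ofReal (p m k) = 1) :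
    ∑' k : ∀ m, K m, ENNReal.ofReal (Real.negMulLog (∏ m, p m (k m))) =
      ∑ m, ∑' k, ENNReal.ofReal (Real.negMulLog (p m k)) := by
  classical
  have hnn : ∀ m m' k, 0 ≤ if m' = m then Real.negMulLog (p m' k) else p m' k := by
    intro m m' k
    split_ifs
    · exact Real.negMulLog_nonneg (hp0 m' k) (hp1 m' k)
    · exact hp0 m' k
  have h1 : ∀ k : ∀ m, K m, ENNReal.ofReal (Real.negMulLog (∏ m, p m (k m))) =
      ∑ m, ∏ m', ENNReal.ofReal
        (if m' = m then Real.negMulLog (p m' (k m')) else p m' (k m')) := by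
    intro k
    rw [negMulLog_prod, ENNReal.ofReal_sum_of_nonneg
      fun m _ => Finset.prod_nonneg fun m' _ => hnn m m' (k m')]
    refine Finset.sum_congr rfl fun m _ => ?_
    rw [ENNReal.ofReal_prod_of_nonneg fun m' _ => hnn m m' (k m')]
  simp only [h1]
  rw [Summable.tsum_finsetSum fun _ _ => ENNReal.summable]
  refine Finset.sum_congr rfl fun m _ => ?_
  rw [ENNReal_tsum_pi_prod K fun m' k =>
    ENNReal.ofReal (if m' = m then Real.negMulLog (p m' k) else p m' k)]
  rw [Finset.prod_eq_single m]
  · simp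
  · intro m' _ h
    simp [h, hp m']
  · simp

end ProductSums

/-! ### Reduced states and product states -/

section Tensor

variable {Λ : Type*} {X : Λ → Type*} {M : Type*}

theorem glue_of_mem {S : Set Λ} (a : Config X S) (z : Config X Sᶜ) {j : Λ} (h : j ∈ S) :
    glue S a z j = a ⟨j, h⟩ := dif_pos h

theorem glue_of_notMem {S : Set Λ} (a : Config X S) (z : Config X Sᶜ) {j : Λ} (h : j ∉ S) :
    glue S a z j = z ⟨j, h⟩ := dif_neg h

@[simp] theorem restr_glue (S : Set Λ) (a : Config X S) (z : Config X Sᶜ) :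
    restr S (glue S a z) = a := funext fun j => glue_of_mem a z j.2

@[simp] theorem restr_compl_glue (S : Set Λ) (a : Config X S) (z : Config X Sᶜ) :
    restr Sᶜ (glue S a z) = z := funext fun j => glue_of_notMem a z j.2

theorem glue_restr (S : Set Λ) (x : ∀ j, X j) : glue S (restr S x) (restr Sᶜ x) = x := by
  funext j
  by_cases h : j ∈ S
  · rw [glue_of_mem _ _ h]; rfl
  · rw [glue_of_notMem _ _ h]; rfl

/-- Configurations are pairs of a configuration on `S` and one off `S`. -/
noncomputable def glueEquiv (X : Λ → Type*) (S : Set Λ) :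
    Config X S × Config X Sᶜ ≃ ((j : Λ) → X j) where
  toFun q := glue S q.1 q.2
  invFun x := (restr S x, restr Sᶜ x)
  left_inv q := by simp
  right_inv x := glue_restr S x

/-- Configurations are families of configurations on the regions of a partition. -/
noncomputable def regionEquiv (X : Λ → Type*) {R : M → Set Λ} (hR : ∀ j, ∃! m, j ∈ R m) :
    ((j : Λ) → X j) ≃ ((m : M) → Config X (R m)) where
  toFun x m := restr (R m) x
  invFun y j := y (hR j).choose ⟨j, (hR j).choose_spec.1⟩
  left_inv x := rfl
  right_inv y := by
    funext m ⟨j, hj⟩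
    obtain rfl := (hR j).choose_spec.2 m hj
    rfl

section Density

variable {ρ : Matrix ((j : Λ) → X j) ((j : Λ) → X j) ℂ}

theorem IsDensity.summable_glue (hρ : IsDensity ρ) (S : Set Λ) (a : Config X S) :
    Summable fun z => (ρ (glue S a z) (glue S a z)).re :=
  hρ.hasSum_diag_re.summable.comp_injective (i := fun z => glue S a z) fun z z' h => by
    simpa using congrArg (restr Sᶜ) h

/-- Off-diagonal entries are dominated by the sum of the two diagonal ones, whose series converge as
parts of the trace. -/
theorem IsDensity.hasSum_reduced (hρ : IsDensity ρ) (S : Set Λ) (a b : Config X S) :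
    HasSum (fun z => ρ (glue S a z) (glue S b z)) (reduced S ρ a b) := by
  refine Summable.hasSum (Summable.of_norm_bounded
    ((hρ.summable_glue S a).add (hρ.summable_glue S b)) fun z => ?_)
  have h := hρ.posSemidef.norm_sq_le (glue S a z) (glue S b z)
  have h1 := hρ.diag_re_nonneg (glue S a z)
  have h2 := hρ.diag_re_nonneg (glue S b z)
  refine le_of_sq_le_sq ?_ (by positivity)
  nlinarith

theorem IsDensity.reduced (hρ : IsDensity ρ) (S : Set Λ) : IsDensity (reduced S ρ) where
  posSemidef := by
    refine ⟨?_, fun x => ?_⟩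
    · ext a b
      rw [Matrix.conjTranspose_apply]
      refine (((hρ.hasSum_reduced S b a).star).unique ?_)
      simpa only [hρ.posSemidef.1.apply] using hρ.hasSum_reduced S a b
    · have h : HasSum (fun z => x.sum fun i xi => x.sum fun j xj =>
          star xi * ρ (glue S i z) (glue S j z) * xj)
          (x.sum fun i xi => x.sum fun j xj => star xi * AreaLaw.reduced S ρ i j * xj) :=
        hasSum_sum fun i _ => hasSum_sum fun j _ =>
          ((hρ.hasSum_reduced S i j).mul_left _).mul_right _
      exact h.nonneg fun z => (hρ.posSemidef.submatrix fun a => glue S a z).2 x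
  trace_one := by
    have h := (glueEquiv X S).hasSum_iff.2 hρ.trace_one
    exact h.prod_fiberwise fun a => hρ.hasSum_reduced S a a

end Density

end Tensor

/-! ### Product states over a partition of the sites -/

section ProductState

universe u₁ u₂ u₃

variable {Λ : Type u₁} {X : Λ → Type u₂} {M : Type u₃} [Fintype M] {R : M → Set Λ}

theorem hasSum_regions {𝕜 : Type*} [RCLike 𝕜] (hR : ∀ j, ∃! m, j ∈ R m)
    {f : ∀ m, Config X (R m) → 𝕜} {s : M → 𝕜} (hf : ∀ m, HasSum (f m) (s m)) :
    HasSum (fun x : (j : Λ) → X j => ∏ m, f m (restr (R m) x)) (∏ m, s m) :=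
  (regionEquiv X hR).hasSum_iff.2 (hasSum_pi_prod hf)

/-- The tensor product of vectors on the regions of a partition. -/
noncomputable def productVector (hR : ∀ j, ∃! m, j ∈ R m) (v : ∀ m, ℓ²(Config X (R m), ℂ)) :
    ℓ²((j : Λ) → X j, ℂ) :=
  ofSummable (fun x => ∏ m, v m (restr (R m) x)) (by
    simp only [norm_prod, ← Finset.prod_pow]
    exact (hasSum_regions hR fun m => hasSum_norm_sq (v m)).summable)

theorem inner_productVector (hR : ∀ j, ∃! m, j ∈ R m) (v w : ∀ m, ℓ²(Config X (R m), ℂ)) :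
    inner ℂ (productVector hR v) (productVector hR w) = ∏ m, inner ℂ (v m) (w m) := by
  refine (lp.hasSum_inner (𝕜 := ℂ) (productVector hR v) (productVector hR w)).unique ?_
  refine (hasSum_regions hR fun m => lp.hasSum_inner (𝕜 := ℂ) (v m) (w m)).congr_fun fun x => ?_
  change inner ℂ (∏ m, v m (restr (R m) x)) (∏ m, w m (restr (R m) x)) = _
  simp only [RCLike.inner_apply, map_prod, Finset.prod_mul_distrib]

theorem IsSpectralDecomposition.product {ρ : Matrix ((j : Λ) → X j) ((j : Λ) → X j) ℂ}
    (hR : ∀ j, ∃! m, j ∈ R m) {K : M → Type*} {p : ∀ m, K m → ℝ}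
    {v : ∀ m, K m → ℓ²(Config X (R m), ℂ)}
    (h : ∀ m, IsSpectralDecomposition (reduced (R m) ρ) (p m) (v m)) :
    IsSpectralDecomposition (productState R ρ) (fun k : ∀ m, K m => ∏ m, p m (k m))
      (fun k => productVector hR fun m => v m (k m)) where
  orthonormal := by
    classical
    rw [orthonormal_iff_ite]
    intro k k'
    rw [inner_productVector]
    simp only [fun m => orthonormal_iff_ite.1 (h m).orthonormal (k m) (k' m)]
    split_ifs with hk
    · simp [hk]
    · obtain ⟨m, hm⟩ := Function.ne_iff.1 hk
      exact Finset.prod_eq_zero (Finset.mem_univ m) (if_neg hm)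
  nonneg k := Finset.prod_nonneg fun m _ => (h m).nonneg (k m)
  tsum_eq_one := by
    simp only [fun k : ∀ m, K m => ENNReal.ofReal_prod_of_nonneg (s := Finset.univ)
      fun m _ => (h m).nonneg (k m)]
    rw [ENNReal_tsum_pi_prod K fun m k => ENNReal.ofReal (p m k)]
    exact Finset.prod_eq_one fun m _ => (h m).tsum_eq_one
  hasSum x y := by
    refine (hasSum_pi_prod fun m => (h m).hasSum (restr (R m) x) (restr (R m) y)).congr_fun
      fun k => ?_
    change ((∏ m, p m (k m) : ℝ) : ℂ) * (∏ m, v m (k m) (restr (R m) x)) *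
      star (∏ m, v m (k m) (restr (R m) y)) = _
    simp only [Complex.ofReal_prod, Finset.prod_mul_distrib, star_prod]

theorem IsDensity.exists_productState_decomposition
    {ρ : Matrix ((j : Λ) → X j) ((j : Λ) → X j) ℂ} (hρ : IsDensity ρ)
    (hR : ∀ j, ∃! m, j ∈ R m) :
    ∃ (K : Type (max u₁ u₂ u₃)) (p : K → ℝ) (v : K → ℓ²((j : Λ) → X j, ℂ)),
      IsSpectralDecomposition (productState R ρ) p v ∧
      ∑ m, entropy (AreaLaw.reduced (R m) ρ) ≤ ∑' k, ENNReal.ofReal (Real.negMulLog (p k)) := by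
  choose K p v h hent using fun m => (hρ.reduced (R m)).exists_spectralDecomposition
  refine ⟨_, _, _, IsSpectralDecomposition.product hR h, ?_⟩
  rw [tsum_negMulLog_pi_prod K p (fun m => (h m).nonneg) (fun m => (h m).le_one)
    fun m => (h m).tsum_eq_one]
  exact Finset.sum_le_sum fun m _ => hent m

/-- Serves to see that the product state is a state, its spectral decomposition being already at
hand. -/
theorem IsSpectralDecomposition.isDensity {Y K : Type*} {ρ : Matrix Y Y ℂ} {p : K → ℝ}
    {v : K → ℓ²(Y, ℂ)} (h : IsSpectralDecomposition ρ p v) : IsDensity ρ := by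
  have hpsd : ρ.PosSemidef := by
    refine ⟨?_, fun x => ?_⟩
    · ext a b
      rw [Matrix.conjTranspose_apply]
      refine (h.hasSum b a).star.unique ((h.hasSum a b).congr_fun fun k => ?_)
      simp only [star_mul', star_star]
      simp only [Complex.star_def, Complex.conj_ofReal]
      ring
    · have h1 : HasSum (fun k => x.sum fun i xi => x.sum fun j xj =>
          star xi * ((p k : ℂ) * v k i * star (v k j)) * xj)
          (x.sum fun i xi => x.sum fun j xj => star xi * ρ i j * xj) :=
        hasSum_sum fun i _ => hasSum_sum fun j _ => ((h.hasSum i j).mul_left _).mul_right _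
      refine h1.nonneg fun k => ?_
      have e : (x.sum fun i xi => x.sum fun j xj =>
          star xi * ((p k : ℂ) * v k i * star (v k j)) * xj) =
          (p k : ℂ) * ((x.sum fun i xi => star xi * v k i) *
            star (x.sum fun i xi => star xi * v k i)) := by
        simp only [Finsupp.sum, star_sum, star_mul', star_star]
        rw [Finset.sum_mul_sum]
        simp only [Finset.mul_sum]
        refine Finset.sum_congr rfl fun i _ => Finset.sum_congr rfl fun j _ => ?_
        ring
      rw [e]
      exact mul_nonneg (Complex.zero_le_real.2 (h.nonneg k)) (mul_star_self_nonneg _)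
  have hre : ∀ x, 0 ≤ (ρ x x).re := fun x =>
    (Complex.nonneg_iff.1 (hpsd.diag_nonneg (i := x))).1
  have hdiag : ∀ x, HasSum (fun k => p k * ‖v k x‖ ^ 2) (ρ x x).re := by
    intro x
    refine (Complex.hasSum_re (h.hasSum x x)).congr_fun fun k => ?_
    rw [mul_assoc, Complex.star_def, Complex.mul_conj, Complex.normSq_eq_norm_sq,
      ← Complex.ofReal_mul, Complex.ofReal_re]
  have hsum : ∑' x, ENNReal.ofReal (ρ x x).re = 1 := by
    have h1 : ∀ x, ENNReal.ofReal (ρ x x).re =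
        ∑' k, ENNReal.ofReal (p k) * ENNReal.ofReal (‖v k x‖ ^ 2) := by
      intro x
      rw [← (hdiag x).tsum_eq, ENNReal.ofReal_tsum_of_nonneg
        (fun k => mul_nonneg (h.nonneg k) (by positivity)) (hdiag x).summable]
      exact tsum_congr fun k => ENNReal.ofReal_mul (h.nonneg k)
    simp only [h1]
    rw [ENNReal.tsum_comm, ← h.tsum_eq_one]
    refine tsum_congr fun k => ?_
    rw [ENNReal.tsum_mul_left, tsum_ofReal_norm_sq, h.orthonormal.1 k]
    simp
  refine ⟨hpsd, ?_⟩
  have h2 : HasSum (fun x => (ρ x x).re) 1 := by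
    have hs : Summable fun x => (ρ x x).re := by
      have := ENNReal.summable_toReal (f := fun x => ENNReal.ofReal (ρ x x).re)
        (by rw [hsum]; simp)
      simpa only [ENNReal.toReal_ofReal (hre _)] using this
    rw [← ENNReal.ofReal_tsum_of_nonneg hre hs, ENNReal.ofReal_eq_one] at hsum
    exact hsum ▸ hs.hasSum
  have h3 := Complex.hasSum_ofReal.2 h2
  rw [Complex.ofReal_one] at h3
  refine h3.congr_fun fun x => ?_
  exact Complex.ext rfl (Complex.nonneg_iff.1 (hpsd.diag_nonneg (i := x))).2.symm

theorem reduced_productState {ρ : Matrix ((j : Λ) → X j) ((j : Λ) → X j) ℂ} (hρ : IsDensity ρ)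
    (hR : ∀ j, ∃! m, j ∈ R m) (m : M) :
    reduced (R m) (productState R ρ) = reduced (R m) ρ := by
  classical
  ext a b
  have h1 : HasSum (fun z : Config X (R m)ᶜ => ∏ m' ∈ Finset.univ.erase m,
      reduced (R m') ρ (restr (R m') (glue (R m) a z)) (restr (R m') (glue (R m) a z))) 1 := by
    -- Putting the indicator of `a` in the factor of region `m` confines the sum to configurations
    -- equal to `a` there, that is, to a sum over the complement of `R m`.
    have h2 := hasSum_regions (X := X) hR (𝕜 := ℂ)
      (f := fun m' c => if h : m' = m then (if c = h ▸ a then 1 else 0)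
        else reduced (R m') ρ c c) (s := fun _ => 1) (fun m' => by
        by_cases h : m' = m
        · subst h
          simpa using hasSum_ite_eq a (1 : ℂ)
        · simpa [h] using (hρ.reduced (R m')).trace_one)
    rw [Finset.prod_const_one] at h2
    have hinj : Function.Injective fun z => glue (R m) a z := fun z z' h => by
      simpa using congrArg (restr (R m)ᶜ) h
    refine ((hinj.hasSum_iff ?_).2 h2).congr_fun fun z => ?_
    · intro x hx
      refine Finset.prod_eq_zero (Finset.mem_univ m) ?_
      have : restr (R m) x ≠ a := by
        rintro rfl
        exact hx ⟨restr (R m)ᶜ x, glue_restr (R m) x⟩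
      simp [this]
    · rw [Function.comp_apply, ← Finset.mul_prod_erase _ _ (Finset.mem_univ m)]
      simp only [restr_glue, dite_true, if_true, one_mul]
      refine Finset.prod_congr rfl fun m' hm' => ?_
      rw [dif_neg (Finset.ne_of_mem_erase hm')]
  have h3 := h1.mul_left (reduced (R m) ρ a b)
  rw [mul_one] at h3
  rw [reduced, ← h3.tsum_eq]
  refine tsum_congr fun z => ?_
  rw [productState, ← Finset.mul_prod_erase _ _ (Finset.mem_univ m), restr_glue, restr_glue]
  congr 1
  refine Finset.prod_congr rfl fun m' hm' => ?_
  congr 1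
  funext j
  have hj : (j : Λ) ∉ R m := fun h =>
    Finset.ne_of_mem_erase hm' ((hR j).unique j.2 h)
  simp only [restr, glue_of_notMem _ _ hj]

end ProductState

/-! ### Expectation values of local observables -/

section Expectation

variable {Λ : Type*} {X : Λ → Type*} {ρ : Matrix ((j : Λ) → X j) ((j : Λ) → X j) ℂ}

theorem extend_glue (S : Set Λ) (A : Matrix (Config X S) (Config X S) ℂ) (a b : Config X S)
    (z z' : Config X Sᶜ) [Decidable (z = z')] :
    extend S A (glue S a z) (glue S b z') = if z = z' then A a b else 0 := by
  classical
  have h : (∀ j, j ∉ S → glue S a z j = glue S b z' j) ↔ z = z' := by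
    constructor
    · intro h
      funext j
      have := h j j.2
      rwa [glue_of_notMem _ _ j.2, glue_of_notMem _ _ j.2] at this
    · rintro rfl j hj
      rw [glue_of_notMem _ _ hj, glue_of_notMem _ _ hj]
  simp only [extend, h, restr_glue]

theorem truncTrace_extend (S : Set Λ) (A : Matrix (Config X S) (Config X S) ℂ)
    (F : Finset (Config X S)) (E : Finset (Config X Sᶜ)) :
    truncTrace (extend S A) ρ ((F ×ˢ E).map (glueEquiv X S).toEmbedding) =
      ∑ a ∈ F, ∑ b ∈ F, A a b * ∑ z ∈ E, ρ (glue S b z) (glue S a z) := by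
  classical
  rw [truncTrace, Finset.sum_map, Finset.sum_product]
  refine Finset.sum_congr rfl fun a _ => ?_
  simp only [Finset.sum_map, Finset.sum_product, Finset.mul_sum]
  rw [Finset.sum_comm]
  refine Finset.sum_congr rfl fun b _ => ?_
  refine Finset.sum_congr rfl fun z hz => ?_
  change ∑ z' ∈ E, extend S A (glue S a z) (glue S b z') * ρ (glue S b z') (glue S a z) = _
  simp only [extend_glue]
  rw [Finset.sum_eq_single z (fun z' _ h => by rw [if_neg h.symm, zero_mul])
    (fun h => absurd hz h), if_pos rfl]

/-- The expectation value of a local observable is that in the reduced state. -/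
theorem tendsto_truncTrace_reduced (hρ : IsDensity ρ) (S : Set Λ)
    (A : Matrix (Config X S) (Config X S) ℂ) (h : HasTrace (extend S A) ρ) :
    Tendsto (truncTrace A (reduced S ρ)) atTop (𝓝 (expect (extend S A) ρ)) := by
  classical
  rw [Metric.tendsto_atTop]
  intro ε hε
  obtain ⟨N₀, hN₀⟩ := Metric.tendsto_atTop.1 h.tendsto (ε / 2) (half_pos hε)
  refine ⟨N₀.image (restr S), fun F hF => ?_⟩
  -- On a product set `F × E` the observable only sees `E` through a partial sum of the partial
  -- trace. Letting `E` grow with `F` fixed keeps the product set above `N₀`, so the error bound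
  -- survives in the limit.
  have hlim : Tendsto (fun E => truncTrace (extend S A) ρ
      ((F ×ˢ E).map (glueEquiv X S).toEmbedding)) atTop
      (𝓝 (truncTrace A (AreaLaw.reduced S ρ) F)) := by
    simp only [truncTrace_extend]
    exact tendsto_finsetSum _ fun a _ => tendsto_finsetSum _ fun b _ =>
      Tendsto.const_mul _ (hρ.hasSum_reduced S b a)
  have hle : dist (truncTrace A (AreaLaw.reduced S ρ) F) (expect (extend S A) ρ) ≤ ε / 2 := by
    refine le_of_tendsto (hlim.dist tendsto_const_nhds) ?_
    filter_upwards [eventually_ge_atTop (N₀.image (restr Sᶜ))] with E hE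
    refine (hN₀ _ fun x hx => ?_).le
    rw [Finset.mem_map]
    exact ⟨(restr S x, restr Sᶜ x), Finset.mem_product.2
      ⟨hF (Finset.mem_image_of_mem _ hx), hE (Finset.mem_image_of_mem _ hx)⟩, glue_restr S x⟩
  linarith

theorem expect_extend_congr {ρ' : Matrix ((j : Λ) → X j) ((j : Λ) → X j) ℂ} (hρ : IsDensity ρ)
    (hρ' : IsDensity ρ') (S : Set Λ) (A : Matrix (Config X S) (Config X S) ℂ)
    (h : HasTrace (extend S A) ρ) (h' : HasTrace (extend S A) ρ')
    (hred : reduced S ρ = reduced S ρ') :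
    expect (extend S A) ρ = expect (extend S A) ρ' := by
  have h1 := tendsto_truncTrace_reduced hρ S A h
  rw [hred] at h1
  exact tendsto_nhds_unique h1 (tendsto_truncTrace_reduced hρ' S A h')

theorem exists_extend_eq_of_subset {S S' : Set Λ} (h : S ⊆ S')
    (A : Matrix (Config X S) (Config X S) ℂ) :
    ∃ B : Matrix (Config X S') (Config X S') ℂ, extend S A = extend S' B := by
  classical
  refine ⟨fun a b => if ∀ j : S', (j : Λ) ∉ S → a j = b j then
    A (fun j => a ⟨j, h j.2⟩) (fun j => b ⟨j, h j.2⟩) else 0, ?_⟩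
  ext x y
  simp only [extend]
  by_cases h1 : ∀ j, j ∉ S → x j = y j
  · rw [if_pos h1, if_pos fun j hj => h1 j fun hjS => hj (h hjS)]
    exact (if_pos fun (j : S') hj => h1 j hj).symm
  · rw [if_neg h1]
    by_cases h2 : ∀ j, j ∉ S' → x j = y j
    · rw [if_pos h2, if_neg]
      intro h3
      refine h1 fun j hj => ?_
      by_cases hj' : j ∈ S'
      · exact h3 ⟨j, hj'⟩ hj
      · exact h2 j hj'
    · rw [if_neg h2]

theorem enorm_sum_sum_le_opNorm {Y : Type*} (A : Matrix Y Y ℂ) (F : Finset Y) (v : Y → ℂ)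
    (hv : ∑ x ∈ F, ‖v x‖ ^ 2 ≤ 1) :
    ‖∑ x ∈ F, ∑ y ∈ F, star (v x) * A x y * v y‖ₑ ≤ opNorm A := by
  classical
  let φ : Y →₀ ℂ := Finsupp.indicator F fun x _ => v x
  have hφ : ∀ x ∈ F, φ x = v x := fun x hx => Finsupp.indicator_of_mem hx _
  have hsub : φ.support ⊆ F := Finsupp.support_indicator_subset _ _
  have hn : φ.sum (fun _ a => ‖a‖ ^ 2) ≤ 1 := by
    rw [Finsupp.sum_of_support_subset _ hsub _ (by simp)]
    rwa [Finset.sum_congr rfl fun x hx => by rw [hφ x hx]]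
  have he : (φ.sum fun x a => φ.sum fun y c => star a * A x y * c) =
      ∑ x ∈ F, ∑ y ∈ F, star (v x) * A x y * v y := by
    rw [Finsupp.sum_of_support_subset _ hsub _ (by simp)]
    refine Finset.sum_congr rfl fun x hx => ?_
    rw [Finsupp.sum_of_support_subset _ hsub _ (by simp)]
    exact Finset.sum_congr rfl fun y hy => by rw [hφ x hx, hφ y hy]
  rw [← he]
  exact le_iSup_of_le φ (le_iSup_of_le φ (le_iSup_of_le hn (le_iSup_of_le hn le_rfl)))

theorem IsSpectralDecomposition.enorm_truncTrace_le {Y K : Type*} {ρ : Matrix Y Y ℂ} {p : K → ℝ}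
    {v : K → ℓ²(Y, ℂ)} (hs : IsSpectralDecomposition ρ p v) (A : Matrix Y Y ℂ) (F : Finset Y) :
    ‖truncTrace A ρ F‖ₑ ≤ opNorm A := by
  have h : HasSum (fun k => (p k : ℂ) * ∑ x ∈ F, ∑ y ∈ F, star (v k x) * A x y * v k y)
      (truncTrace A ρ F) := by
    refine HasSum.congr_fun (hasSum_sum fun x (_ : x ∈ F) => hasSum_sum fun y (_ : y ∈ F) =>
      (hs.hasSum y x).mul_left (A x y)) fun k => ?_
    rw [Finset.mul_sum]
    refine Finset.sum_congr rfl fun x _ => ?_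
    rw [Finset.mul_sum]
    exact Finset.sum_congr rfl fun y _ => by ring
  have hb : ∀ k, ‖∑ x ∈ F, ∑ y ∈ F, star (v k x) * A x y * v k y‖ₑ ≤ opNorm A := fun k => by
    refine enorm_sum_sum_le_opNorm A F (v k) ?_
    have := sum_le_hasSum F (fun y _ => by positivity) (hasSum_norm_sq (v k))
    rwa [hs.orthonormal.1 k, one_pow] at this
  rw [← h.tsum_eq]
  refine enorm_tsum_le_tsum_enorm.trans ?_
  calc ∑' k, ‖(p k : ℂ) * ∑ x ∈ F, ∑ y ∈ F, star (v k x) * A x y * v k y‖ₑ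
      ≤ ∑' k, ENNReal.ofReal (p k) * opNorm A := by
        refine ENNReal.tsum_le_tsum fun k => ?_
        rw [enorm_mul]
        refine mul_le_mul' (le_of_eq ?_) (hb k)
        rw [← ofReal_norm, Complex.norm_real, Real.norm_of_nonneg (hs.nonneg k)]
    _ = opNorm A := by rw [ENNReal.tsum_mul_right, hs.tsum_eq_one, one_mul]

theorem enorm_expect_extend_le (hρ : IsDensity ρ) (S : Set Λ)
    (A : Matrix (Config X S) (Config X S) ℂ) (h : HasTrace (extend S A) ρ) :
    ‖expect (extend S A) ρ‖ₑ ≤ opNorm A := by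
  obtain ⟨K, p, v, hs, -⟩ := (hρ.reduced S).exists_spectralDecomposition
  exact le_of_tendsto (tendsto_truncTrace_reduced hρ S A h).enorm
    (Eventually.of_forall fun F => hs.enorm_truncTrace_le A F)

end Expectation

/-! ### Geometry of the tiling -/

section Tiling

variable {d n r l : ℕ}

theorem existsUnique_mem_cube (hl : 1 ≤ l) (hln : l ∣ n) (i : Site d n) :
    ∃! m : CubeLabel d n l, i ∈ cube l m := by
  refine ⟨fun a => ⟨(i a : ℕ) / l, ?_⟩, fun a => rfl, fun m hm => ?_⟩
  · rw [Nat.div_lt_iff_lt_mul hl, Nat.div_mul_cancel hln]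
    exact (i a).2
  · funext a
    exact Fin.ext (hm a).symm

theorem ball_subset_cube {m : CubeLabel d n l} {i : Site d n} (hi : i ∈ cube l m)
    (hb : i ∉ cubeBoundary l r m) : ball r i ⊆ cube l m := by
  intro j hj a
  have h1 : ∀ a, r ≤ (i a : ℕ) % l ∧ (i a : ℕ) % l + r < l := by
    by_contra h
    exact hb ⟨hi, h⟩
  have h2 : |((i a : ℕ) : ℤ) - ((j a : ℕ) : ℤ)| ≤ r :=
    (Finset.single_le_sum (f := fun a => |((i a : ℕ) : ℤ) - ((j a : ℕ) : ℤ)|)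
      (fun _ _ => abs_nonneg _) (Finset.mem_univ a)).trans hj
  rw [abs_le] at h2
  obtain ⟨h3, h4⟩ := h1 a
  have h5 := Nat.div_add_mod (i a : ℕ) l
  have hi' := hi a
  rw [hi'] at h5
  rw [Nat.div_eq_iff (by omega)]
  constructor
  · rw [mul_comm]; omega
  · rw [mul_comm]; omega

theorem card_boundary_le (hl : 1 ≤ l) (hln : l ∣ n) (s : Finset (Site d n))
    (hs : ∀ i ∈ s, ∃ m : CubeLabel d n l, i ∈ cubeBoundary l r m) :
    (s.card : ℝ) ≤ 2 * d * r * (n : ℝ) ^ d / l := by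
  classical
  -- A boundary site has some coordinate in this set. Each of the `n / l` intervals contributes at
  -- most `2 r` values, also when the two strips overlap or `r > l`.
  set bad : Finset (Fin n) :=
    Finset.univ.filter fun x : Fin n => ¬ (r ≤ (x : ℕ) % l ∧ (x : ℕ) % l + r < l) with hbad
  have hbadcard : bad.card ≤ (n / l) * (2 * r) := by
    have h1 : bad.card ≤ (Finset.range (n / l) ×ˢ (Finset.range r ∪ Finset.Ico (l - r) l)).card := by
      refine Finset.card_le_card_of_injOn (fun x => ((x : ℕ) / l, (x : ℕ) % l)) ?_ ?_
      · intro x hx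
        have hx' : ¬ (r ≤ (x : ℕ) % l ∧ (x : ℕ) % l + r < l) := by simpa [hbad] using hx
        have h2 : (x : ℕ) / l < n / l := by
          rw [Nat.div_lt_iff_lt_mul hl, Nat.div_mul_cancel hln]
          exact x.2
        have h3 := Nat.mod_lt (x : ℕ) (show 0 < l by omega)
        simp only [Finset.coe_product, Set.mem_prod, Finset.mem_coe, Finset.mem_range,
          Finset.mem_union, Finset.mem_Ico]
        refine ⟨h2, ?_⟩
        omega
      · intro x _ y _ hxy
        simp only [Prod.mk.injEq] at hxy
        have hx := Nat.div_add_mod (x : ℕ) l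
        rw [hxy.1, hxy.2, Nat.div_add_mod] at hx
        exact Fin.ext hx.symm
    refine h1.trans ?_
    rw [Finset.card_product, Finset.card_range]
    refine Nat.mul_le_mul_left _ ((Finset.card_union_le _ _).trans ?_)
    rw [Finset.card_range, Nat.card_Ico]
    omega
  have hpi : ∀ a : Fin d, (Fintype.piFinset fun b : Fin d => if b = a then bad else Finset.univ).card
      = bad.card * n ^ (d - 1) := by
    intro a
    rw [Fintype.card_piFinset, ← Finset.mul_prod_erase _ _ (Finset.mem_univ a), if_pos rfl]
    congr 1
    rw [Finset.prod_congr rfl fun b hb => by rw [if_neg (Finset.ne_of_mem_erase hb)]]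
    simp
  have hsub : s ⊆ Finset.univ.biUnion fun a : Fin d =>
      Fintype.piFinset fun b : Fin d => if b = a then bad else Finset.univ := by
    intro i hi
    obtain ⟨m, -, hm⟩ := hs i hi
    rw [not_forall] at hm
    obtain ⟨a, ha⟩ := hm
    rw [Finset.mem_biUnion]
    refine ⟨a, Finset.mem_univ a, ?_⟩
    rw [Fintype.mem_piFinset]
    intro b
    by_cases h : b = a
    · subst h
      rw [if_pos rfl]
      simpa [hbad] using ha
    · simp [h]
  have hcard : s.card ≤ d * ((n / l) * (2 * r) * n ^ (d - 1)) := by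
    refine (Finset.card_le_card hsub).trans (Finset.card_biUnion_le.trans ?_)
    simp only [hpi, Finset.sum_const, Finset.card_univ, Fintype.card_fin, smul_eq_mul]
    gcongr
  rcases Nat.eq_zero_or_pos d with rfl | hd
  · have h0 : s.card = 0 := by simpa using hcard
    simp [h0]
  have hl0 : (l : ℝ) ≠ 0 := by positivity
  calc (s.card : ℝ) ≤ ((d * ((n / l) * (2 * r) * n ^ (d - 1)) : ℕ) : ℝ) := by exact_mod_cast hcard
    _ = 2 * d * r * ((n : ℝ) ^ (d - 1) * n) / l := by
        push_cast [Nat.cast_div hln hl0]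
        field_simp
    _ = _ := by rw [← pow_succ, Nat.sub_add_cancel hd]

end Tiling

/-! ### The energy of the product state -/

section Energy

theorem truncTrace_sum {Y I : Type*} (s : Finset I) (A : I → Matrix Y Y ℂ) (ρ : Matrix Y Y ℂ)
    (N : Finset Y) : truncTrace (∑ i ∈ s, A i) ρ N = ∑ i ∈ s, truncTrace (A i) ρ N := by
  simp only [truncTrace, Matrix.sum_apply, Finset.sum_mul]
  rw [Finset.sum_comm (s := s)]
  exact Finset.sum_congr rfl fun x _ => Finset.sum_comm

variable {d n r l : ℕ} {X : Site d n → Type*} (H : LocalHamiltonian r X)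
  {σ : Matrix ((j : Site d n) → X j) ((j : Site d n) → X j) ℂ}

theorem LocalHamiltonian.tendsto_total (htr : ∀ i, HasTrace (H.globalTerm i) σ) :
    Tendsto (truncTrace H.total σ) atTop (𝓝 (∑ i, expect (H.globalTerm i) σ)) := by
  have h := tendsto_finsetSum Finset.univ fun i _ => (htr i).tendsto
  refine h.congr fun N => ?_
  rw [LocalHamiltonian.total, truncTrace_sum]

-- The factor `2` comes from the norm branch of the minimum, where the correlation is a difference
-- of two expectation values. In the other branch it is a loss.
variable (l) in
theorem LocalHamiltonian.norm_correlation_le (hσ : IsDensity σ)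
    (hσ' : IsDensity (productState (cube (n := n) l) σ))
    (htr : ∀ i, HasTrace (H.globalTerm i) σ)
    (htr' : ∀ i, HasTrace (H.globalTerm i) (productState (cube (n := n) l) σ))
    {m : CubeLabel d n l} {i : Site d n} (hi : i ∈ cubeBoundary l r m) :
    ‖H.correlation l σ i‖ ≤ 2 * H.strength l σ := by
  set a := ⨆ i, opNorm (H.term i) with ha
  set b := ⨆ (m : CubeLabel d n l) (i ∈ cubeBoundary l r m), ‖H.correlation l σ i‖ₑ with hb
  have hb1 : ‖H.correlation l σ i‖ₑ ≤ b :=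
    le_iSup_of_le m (le_iSup_of_le i (le_iSup_of_le hi le_rfl))
  -- The lattice is finite, so the minimum is finite even for unbounded terms and `toReal` in
  -- `strength` does not collapse it to `0`.
  have hbtop : b ≠ ⊤ := by
    have : b ≤ ∑ i, ‖H.correlation l σ i‖ₑ :=
      iSup_le fun m => iSup_le fun i => iSup_le fun _ =>
        Finset.single_le_sum (f := fun i => ‖H.correlation l σ i‖ₑ) (fun _ _ => zero_le)
          (Finset.mem_univ i)
    exact ne_top_of_le_ne_top (ENNReal.sum_ne_top.2 fun i _ => enorm_ne_top) this
  have ha1 : ‖H.correlation l σ i‖ₑ ≤ 2 * a := by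
    rw [two_mul]
    refine (enorm_sub_le).trans (add_le_add ?_ ?_)
    · exact (enorm_expect_extend_le hσ _ _ (htr i)).trans
        (le_iSup (fun i => opNorm (H.term i)) i)
    · exact (enorm_expect_extend_le hσ' _ _ (htr' i)).trans
        (le_iSup (fun i => opNorm (H.term i)) i)
  have h : ‖H.correlation l σ i‖ₑ ≤ 2 * min a b := by
    rcases min_choice a b with h | h
    · rw [h]; exact ha1
    · rw [h, two_mul]; exact hb1.trans le_self_add
  have hmin : min a b ≠ ⊤ := ne_top_of_le_ne_top hbtop (min_le_right _ _)
  have h2 := ENNReal.toReal_mono (ENNReal.mul_ne_top ENNReal.ofNat_ne_top hmin) h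
  simpa [LocalHamiltonian.strength] using h2

/-- The ball lies in one cube, so the term is an observable of that cube, on which `σ` and the
product state have the same reduced state. -/
theorem LocalHamiltonian.correlation_eq_zero (hσ : IsDensity σ)
    (hσ' : IsDensity (productState (cube (n := n) l) σ)) (hl : 1 ≤ l) (hln : l ∣ n)
    (htr : ∀ i, HasTrace (H.globalTerm i) σ)
    (htr' : ∀ i, HasTrace (H.globalTerm i) (productState (cube (n := n) l) σ))
    {m : CubeLabel d n l} {i : Site d n} (hi : i ∈ cube l m) (hb : i ∉ cubeBoundary l r m) :
    H.correlation l σ i = 0 := by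
  obtain ⟨B, hB⟩ := exists_extend_eq_of_subset (ball_subset_cube hi hb) (H.term i)
  have hB' : H.globalTerm i = extend (cube l m) B := hB
  rw [LocalHamiltonian.correlation, hB', sub_eq_zero]
  refine expect_extend_congr hσ hσ' _ _ (hB' ▸ htr i) (hB' ▸ htr' i) ?_
  exact (reduced_productState hσ (existsUnique_mem_cube hl hln) m).symm

theorem LocalHamiltonian.strength_nonneg : 0 ≤ H.strength l σ := ENNReal.toReal_nonneg

theorem LocalHamiltonian.expect_productState_le (hσ : IsDensity σ)
    (hσ' : IsDensity (productState (cube (n := n) l) σ)) (hl : 1 ≤ l) (hln : l ∣ n)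
    (htr : ∀ i, HasTrace (H.globalTerm i) σ)
    (htr' : ∀ i, HasTrace (H.globalTerm i) (productState (cube (n := n) l) σ)) {C : ℝ}
    (henergy : (expect H.total σ).re ≤ C * (n : ℝ) ^ d / l) :
    (expect H.total (productState (cube (n := n) l) σ)).re ≤
      (n : ℝ) ^ d * ((C + 4 * d * r * H.strength l σ) / l) := by
  classical
  have hh := H.strength_nonneg (l := l) (σ := σ)
  rw [expect_eq (H.tendsto_total htr)] at henergy
  rw [expect_eq (H.tendsto_total htr')]
  set s : Finset (Site d n) :=
    Finset.univ.filter fun i => ∃ m : CubeLabel d n l, i ∈ cubeBoundary l r m with hs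
  have hcorr : ∀ i, -(H.correlation l σ i).re ≤ if i ∈ s then 2 * H.strength l σ else 0 := by
    intro i
    split_ifs with h
    · obtain ⟨m, hm⟩ := (Finset.mem_filter.1 h).2
      exact ((neg_le_abs _).trans (Complex.abs_re_le_norm _)).trans
        (H.norm_correlation_le l hσ hσ' htr htr' hm)
    · obtain ⟨m, hm, -⟩ := existsUnique_mem_cube hl hln i
      rw [H.correlation_eq_zero hσ hσ' hl hln htr htr' hm
        fun hb => h (Finset.mem_filter.2 ⟨Finset.mem_univ i, m, hb⟩)]
      simp
  have hsum := Finset.sum_le_sum fun i (_ : i ∈ Finset.univ) => hcorr i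
  rw [Finset.sum_ite_mem, Finset.univ_inter, Finset.sum_const, nsmul_eq_mul] at hsum
  simp only [LocalHamiltonian.correlation, Complex.sub_re, neg_sub] at hsum
  rw [Finset.sum_sub_distrib, ← Complex.re_sum, ← Complex.re_sum] at hsum
  have hcard := card_boundary_le (r := r) hl hln s fun i hi => (Finset.mem_filter.1 hi).2
  have h1 : (s.card : ℝ) * (2 * H.strength l σ) ≤
      2 * d * r * (n : ℝ) ^ d / l * (2 * H.strength l σ) := by gcongr
  have h2 : C * (n : ℝ) ^ d / l + 2 * d * r * (n : ℝ) ^ d / l * (2 * H.strength l σ) =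
      (n : ℝ) ^ d * ((C + 4 * d * r * H.strength l σ) / l) := by ring
  linarith

/-- The mean entropy of the cubes is bounded by the free energy at any temperature. -/
theorem meanCubeEntropy_le (hn : 1 ≤ n) (hl : 1 ≤ l) (hln : l ∣ n) {ι : Type*}
    (G : GibbsSpectrum H.total ι) (hσ : IsDensity σ)
    (htr : ∀ i, HasTrace (H.globalTerm i) σ)
    (htr' : ∀ i, HasTrace (H.globalTerm i) (productState (cube (n := n) l) σ)) {C : ℝ}
    (henergy : (expect H.total σ).re ≤ C * (n : ℝ) ^ d / l) {T : ℝ} (hT : 0 < T) :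
    meanCubeEntropy l σ ≤ ENNReal.ofReal ((l : ℝ) ^ d *
      ((C + 4 * d * r * H.strength l σ) / l / T +
        Real.log (G.partitionFunction T) / (n : ℝ) ^ d)) := by
  obtain ⟨K, p, v, hs, hent⟩ := hσ.exists_productState_decomposition
    (existsUnique_mem_cube (d := d) hl hln)
  have hgibbs := hs.tsum_negMulLog_le G ⟨_, H.tendsto_total htr'⟩ hT
  have hE := H.expect_productState_le hσ hs.isDensity hl hln htr htr' henergy
  have hnl : 0 < n / l := Nat.div_pos (Nat.le_of_dvd hn hln) hl
  have hM : ((n / l : ℕ) : ℝ) = n / l := Nat.cast_div hln (by positivity)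
  have hM0 : (0 : ℝ) < ((n / l : ℕ) : ℝ) ^ d := by positivity
  have hn0 : (0 : ℝ) < n := by positivity
  have hl0 : (0 : ℝ) < l := by positivity
  have hcard : (Fintype.card (CubeLabel d n l) : ℝ≥0∞) =
      ENNReal.ofReal (((n / l : ℕ) : ℝ) ^ d) := by
    rw [ENNReal.ofReal_pow (by positivity), ENNReal.ofReal_natCast]
    simp
  rw [meanCubeEntropy, hcard]
  refine (ENNReal.div_le_div_right (hent.trans hgibbs) _).trans ?_
  rw [← ENNReal.ofReal_div_of_pos hM0]
  refine ENNReal.ofReal_le_ofReal ?_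
  rw [div_le_iff₀ hM0, hM, div_pow]
  have h1 : (l : ℝ) ^ d * ((C + 4 * d * r * H.strength l σ) / l / T +
      Real.log (G.partitionFunction T) / (n : ℝ) ^ d) * ((n : ℝ) ^ d / (l : ℝ) ^ d) =
      (n : ℝ) ^ d * ((C + 4 * d * r * H.strength l σ) / l) / T +
        Real.log (G.partitionFunction T) := by
    field_simp
  rw [h1]
  gcongr

end Energy

end AreaLaw

/-! ### Choice of the temperature and scaling in the cube size -/

theorem mainTheorem3 {d n r l : ℕ} (hd : 1 ≤ d) (hn : 1 ≤ n) (hl : 1 ≤ l) (hln : l ∣ n)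
    {X : AreaLaw.Site d n → Type*} {ι : Type*}
    (H : AreaLaw.LocalHamiltonian r X) (G : AreaLaw.GibbsSpectrum H.total ι)
    (σ : Matrix ((j : AreaLaw.Site d n) → X j) ((j : AreaLaw.Site d n) → X j) ℂ)
    (hσ : AreaLaw.IsDensity σ)
    (htr : ∀ i, AreaLaw.HasTrace (H.globalTerm i) σ)
    (htr' : ∀ i, AreaLaw.HasTrace (H.globalTerm i)
      (AreaLaw.productState (AreaLaw.cube (n := n) l) σ))
    (C : ℝ) (hC : 1 ≤ C)
    (henergy : (AreaLaw.expect H.total σ).re ≤ C * (n : ℝ) ^ d / l)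
    (Tc : ℝ) (hTc : 0 < Tc)
    (hu : G.energyDensity ((n : ℝ) ^ d) Tc = (C + 4 * d * r * H.strength l σ) / l) :
    (∀ k γ Δ : ℝ, 0 < k → 0 < γ → 0 < Δ →
      (∀ T, 0 < T → T ≤ Tc → G.specificHeat ((n : ℝ) ^ d) T ≤ k * (T / Δ) ^ γ) →
      AreaLaw.meanCubeEntropy l σ ≤ ENNReal.ofReal
        (G.entropyDensity ((n : ℝ) ^ d) 0 * (l : ℝ) ^ d +
          (k ^ (1 / (γ + 1)) / γ * (γ + 1) ^ (γ / (γ + 1)) *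
            ((C + 4 * d * r * H.strength l σ) / Δ) ^ (γ / (γ + 1)) *
            (l : ℝ) ^ (1 / (γ + 1))) * (l : ℝ) ^ (d - 1))) ∧
    (∀ k γ Δ : ℝ, 0 < k → 0 < γ → 0 < Δ →
      (∀ T, 0 < T → T ≤ Tc →
        G.specificHeat ((n : ℝ) ^ d) T ≤ k * (Δ / T) ^ γ * Real.exp (-(Δ / T))) →
      AreaLaw.meanCubeEntropy l σ ≤ ENNReal.ofReal
        (G.entropyDensity ((n : ℝ) ^ d) 0 * (l : ℝ) ^ d +
          (2 * (max 0 (Real.log (k * Δ * γ ^ (γ - 1)) + Real.log l) + 1 + γ / 2) *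
            ((C + 4 * d * r * H.strength l σ) / Δ)) * (l : ℝ) ^ (d - 1))) := by
  have hn0 : (0 : ℝ) < n := by positivity
  have hl0 : (0 : ℝ) < l := by positivity
  have hh := H.strength_nonneg (l := l) (σ := σ)
  set U := C + 4 * d * r * H.strength l σ with hU
  -- Through `1 ≤ C` this supplies the lower bound `1 / l ≤ U / l` required in the gapped case.
  have hU1 : 1 ≤ U := by
    have : 0 ≤ 4 * d * r * H.strength l σ := by positivity
    linarith
  have hpow : (l : ℝ) ^ d = (l : ℝ) ^ (d - 1) * l := by
    rw [← pow_succ, Nat.sub_add_cancel hd]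
  refine ⟨fun k γ Δ hk hγ hΔ hc => ?_, fun k γ Δ hk hγ hΔ hc => ?_⟩
  · obtain ⟨T, hT, hle⟩ := G.exists_temperature_of_rpow_bound hTc (by positivity) hu hk hγ hΔ hc
    refine (AreaLaw.meanCubeEntropy_le H hn hl hln G hσ htr htr' henergy hT).trans
      (ENNReal.ofReal_le_ofReal ?_)
    refine (mul_le_mul_of_nonneg_left hle (by positivity)).trans_eq ?_
    -- Since `γ / (γ + 1) + 1 / (γ + 1) = 1`, the volume factor `l ^ d` loses only the power `γ / (γ
    -- + 1)` of `l`; this leaves `l ^ (1 / (γ + 1))` beyond the area.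
    have h1 : (U / l / Δ) ^ (γ / (γ + 1)) * l =
        (U / Δ) ^ (γ / (γ + 1)) * (l : ℝ) ^ (1 / (γ + 1)) := by
      have h2 : (l : ℝ) = (l : ℝ) ^ (1 / (γ + 1)) * (l : ℝ) ^ (γ / (γ + 1)) := by
        rw [← Real.rpow_add hl0, ← add_div, add_comm, div_self (by positivity), Real.rpow_one]
      have h3 : (l : ℝ) ^ (γ / (γ + 1)) ≠ 0 := (Real.rpow_pos_of_pos hl0 _).ne'
      rw [div_right_comm, Real.div_rpow (by positivity) hl0.le, div_mul_eq_mul_div,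
        div_eq_iff h3, mul_assoc, ← h2]
    rw [mul_add, hpow]
    linear_combination (k ^ (1 / (γ + 1)) / γ * (γ + 1) ^ (γ / (γ + 1)) * (l : ℝ) ^ (d - 1)) * h1
  · obtain ⟨T, hT, hle⟩ := G.exists_temperature_of_gap_bound hTc hl0
      (by gcongr) hu hk hγ hΔ hc
    refine (AreaLaw.meanCubeEntropy_le H hn hl hln G hσ htr htr' henergy hT).trans
      (ENNReal.ofReal_le_ofReal ?_)
    refine (mul_le_mul_of_nonneg_left hle (by positivity)).trans_eq ?_
    rw [mul_add, hpow]
    field_simp
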